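/- Let $B_3=\langle\sigma_1,\sigma_2\mid\sigma_1\sigma_2\sigma_1=\sigma_2\sigma_1\sigma_2\rangle$ be the braid group on three strands and let $\rho:B_3\to GL(V)$ be a simple complex representation with $\dim V=d\le 5$. Put $A=\rho(\sigma_1)$ and $B=\rho(\sigma_2)$, and suppose that the eigenvalues $\lambda_1,\dots,\lambda_d$ of $A$ (which are also those of $B$) are distinct and of modulus $1$. For $M\in\{A,B\}$ let $$e_{M,i}=\prod_{j\neq i}\frac{M-\lambda_j}{\lambda_i-\lambda_j}$$ be the eigenprojection of $M$ onto its $\lambda_i$-eigenspace. Then there are unique real numbers $\mu^{(d)}_{ij}$ $(1\le i,j\le d)$ with $$e_{B,i}\,e_{A,j}\,e_{B,i}=\mu^{(d)}_{ij}\,e_{B,i},$$ and for $i\neq j$ they are given by $$\mu^{(d)}_{ij}=\frac{Q^{(d)}_{ij}}{\prod_{k\neq i}(\lambda_i-\lambda_k)\,\prod_{k\neq j}(\lambda_j-\lambda_k)},$$ where, for $r\neq s$, $$Q^{(2)}_{rs}=-\lambda_r^2+\lambda_r\lambda_s-\lambda_s^2,$$ $$Q^{(3)}_{rs}=(\lambda_r^2+\lambda_s\lambda_k)(\lambda_s^2+\lambda_r\lambda_k)\qquad(k\neq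 r,s),$$ $$Q^{(4)}_{rs}=-\gamma^{-1}(\lambda_r^2+\gamma)(\lambda_s^2+\gamma)(\gamma+\lambda_r\lambda_k+\lambda_s\lambda_l)(\gamma+\lambda_r\lambda_l+\lambda_s\lambda_k)\qquad(\{k,l\}=\{1,2,3,4\}\setminus\{r,s\}),$$ $$Q^{(5)}_{rs}=\gamma^{-8}(\gamma^2+\lambda_r\gamma+\lambda_r^2)(\gamma^2+\lambda_s\gamma+\lambda_s^2)\prod_{k\neq r,s}(\gamma^2+\lambda_r\lambda_k)(\gamma^2+\lambda_s\lambda_k).$$ Here, for $d=4$, $\gamma$ is the square root of $\lambda_1\lambda_2\lambda_3\lambda_4$ with $\rho((\sigma_1\sigma_2)^3)=-\gamma^3\,\mathrm{id}_V$, and, for $d=5$, $\gamma$ is the fifth root of $\lambda_1\cdots\lambda_5$ with $\rho((\sigma_1\sigma_2)^3)=\gamma^6\,\mathrm{id}_V$. Moreover, $\rho$ is unitarizable (that is, $V$ carries a positive definite Hermitian inner product for which $\rho(g)$ is unitary for every $g\in B_3$) if and only if $\mu^{(d)}_{1i}>0$ for all $2\le i\le d$. -/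

import Mathlib

noncomputable section

/-- The braid relation `σ₁ σ₂ σ₁ = σ₂ σ₁ σ₂`, as a relator in the free group on two letters. -/
def braidRels : Set (FreeGroup (Fin 2)) :=
  {FreeGroup.of 0 * FreeGroup.of 1 * FreeGroup.of 0 *
    (FreeGroup.of 1 * FreeGroup.of 0 * FreeGroup.of 1)⁻¹}

/-- The braid group on three strands, in Artin's presentation. -/
abbrev BraidGroup3 : Type := PresentedGroup braidRels

/-- The first standard generator. -/
def sigma1 : BraidGroup3 := PresentedGroup.of 0

/-- The second standard generator. -/
def sigma2 : BraidGroup3 := PresentedGroup.of 1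

/-- A complex representation is unitarizable if its space carries a (positive definite, Hermitian)
inner product that is preserved by every group element. -/
def IsUnitarizable {G V : Type*} [Group G] [AddCommGroup V] [Module ℂ V]
    (ρ : Representation ℂ G V) : Prop :=
  ∃ c : InnerProductSpace.Core ℂ V,
    ∀ (g : G) (v w : V), c.inner (ρ g v) (ρ g w) = c.inner v w

/-- The eigenprojection `∏_{j ≠ i} (M - λ_j) / (λ_i - λ_j)`: the Lagrange basis polynomial
`∏_{j ≠ i} (X - λ_j) / (λ_i - λ_j)`, evaluated at `M`. -/
def eigenProj {V : Type*} [AddCommGroup V] [Module ℂ V] {d : ℕ}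
    (M : Module.End ℂ V) (lam : Fin d → ℂ) (i : Fin d) : Module.End ℂ V :=
  Polynomial.aeval M (Lagrange.basis Finset.univ lam i)

/-- `μ` satisfies `e_{B,i} e_{A,j} e_{B,i} = μ_{ij} e_{B,i}` for all `i, j`, where `A` and `B` are
the images of the two generators. -/
def IsMu {V : Type*} [AddCommGroup V] [Module ℂ V] {d : ℕ}
    (ρ : Representation ℂ BraidGroup3 V) (lam : Fin d → ℂ) (μ : Fin d → Fin d → ℝ) : Prop :=
  ∀ i j : Fin d,
    eigenProj (ρ sigma2) lam i * eigenProj (ρ sigma1) lam j * eigenProj (ρ sigma2) lam i =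
      (μ i j : ℂ) • eigenProj (ρ sigma2) lam i

/-- The functions `Q^{(d)}_{rs}` of the eigenvalues, for `r ≠ s` and `2 ≤ d ≤ 5` (the value is
irrelevant otherwise). The parameter `γ` is used for `d = 4` and `d = 5` only. For `d = 4` the
product runs over the two ordered pairs `(k, l)` with `{k, l}` the complement of `{r, s}`. -/
def braidQ {d : ℕ} (lam : Fin d → ℂ) (γ : ℂ) (r s : Fin d) : ℂ :=
  match d with
  | 2 => -(lam r) ^ 2 + lam r * lam s - (lam s) ^ 2
  | 3 => ∏ k ∈ ({r, s} : Finset (Fin 3))ᶜ,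
      ((lam r) ^ 2 + lam s * lam k) * ((lam s) ^ 2 + lam r * lam k)
  | 4 => -γ⁻¹ * ((lam r) ^ 2 + γ) * ((lam s) ^ 2 + γ) *
      ∏ p ∈ (({r, s} : Finset (Fin 4))ᶜ).offDiag, (γ + lam r * lam p.1 + lam s * lam p.2)
  | 5 => (γ ^ 8)⁻¹ * (γ ^ 2 + lam r * γ + (lam r) ^ 2) * (γ ^ 2 + lam s * γ + (lam s) ^ 2) *
      ∏ k ∈ ({r, s} : Finset (Fin 5))ᶜ,
        (γ ^ 2 + lam r * lam k) * (γ ^ 2 + lam s * lam k)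
  | _ => 0

/-- `Q_{ij} / (∏_{k ≠ i} (λ_i - λ_k) ∏_{k ≠ j} (λ_j - λ_k))`. -/
def muFormula {d : ℕ} (lam : Fin d → ℂ) (γ : ℂ) (i j : Fin d) : ℂ :=
  braidQ lam γ i j /
    ((∏ k ∈ Finset.univ.erase i, (lam i - lam k)) * ∏ k ∈ Finset.univ.erase j, (lam j - lam k))

/-- For `d = 4`, `γ` is the square root of the product of the eigenvalues with
`ρ((σ₁σ₂)³) = -γ³`; for `d = 5`, it is the fifth root of that product with `ρ((σ₁σ₂)³) = γ⁶`.
No condition for other `d`, where `γ` does not occur in `braidQ`. -/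
def IsBraidRoot {V : Type*} [AddCommGroup V] [Module ℂ V] {d : ℕ}
    (ρ : Representation ℂ BraidGroup3 V) (lam : Fin d → ℂ) (γ : ℂ) : Prop :=
  (d = 4 → γ ^ 2 = ∏ i, lam i ∧
    ρ ((sigma1 * sigma2) ^ 3) = (-γ ^ 3) • (1 : Module.End ℂ V)) ∧
  (d = 5 → γ ^ 5 = ∏ i, lam i ∧
    ρ ((sigma1 * sigma2) ^ 3) = (γ ^ 6) • (1 : Module.End ℂ V))

end

/-! Put S = ABA and T = AB. Then S conjugates A into B, and S² = T³ commutes with both generators,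
so by Schur it is a scalar c. In an eigenbasis of A let b be the matrix of B. The projections
e_{A,i} become matrix units and e_{B,i} = S e_{A,i} S⁻¹, whence μ_ij = S_ij S_ji / c = λ_i² λ_j²
b_ij b_ji / c. Everything is thus a question about the products b_ij b_ji.

The eigenvalues of S are square roots of c, those of T cube roots. A common eigenvector would span
an invariant line, so for d ≥ 2 an eigenspace of S and one of T have dimensions adding up to at most
d. For 2 ≤ d ≤ 5 this, the determinants, and the occurrence of all three cube roots when d ≥ 3 fix
the multiplicities, hence the traces of S, T and T² (`traces_two` to `traces_five`), in terms of det
A and, for d = 4, 5, the root γ read off from c. These are traces of A^m B, and a Vandermonde system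
yields the diagonal entries b_ii. The braid relation also gives the moments Σ_j λ_j^m b_ij b_jk for
m = 1, 2, 3 and relates m = 4 to m = 0; at k = i, eliminating the remaining indices produces the
formula for b_ij b_ji. For unimodular λ_i, numerator and denominator of the formula change by the
same factor under conjugation, so the μ_ij are real.

If ρ is unitary, the eigenbasis is orthogonal and S* = S/c, so μ_ij is a positive multiple of
|S_ji|². This is nonzero by irreducibility: as d ≤ 5, a vanishing entry would leave at most three
indices, on which three vanishing moments kill all products b_ij b_jk. Conversely, positive μ_{0j}
dictate weights on the eigenbasis making S self-adjoint up to c. Compatibility for the other pairs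
comes from symmetry and reality of the triple products b_0i b_ij b_j0, again by three moments. -/

/-- No proper nonzero subspace is invariant under both `A` and `B`. -/
def JointlyIrreducible {V : Type*} [AddCommGroup V] [Module ℂ V] (A B : Module.End ℂ V) : Prop :=
  ∀ W : Submodule ℂ V, (∀ x ∈ W, A x ∈ W) → (∀ x ∈ W, B x ∈ W) → W = ⊥ ∨ W = ⊤

/-- `A` and `B` satisfy the braid relation, and `(A B A) ^ 2` is the nonzero scalar `c`. -/
structure IsBraidPair {V : Type*} [AddCommGroup V] [Module ℂ V] (A B : Module.End ℂ V) (c : ℂ) :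
    Prop where
  braid : A * B * A = B * A * B
  sq : (A * B * A) * (A * B * A) = c • 1
  ne_zero : c ≠ 0

theorem braid_sigma : sigma1 * sigma2 * sigma1 = sigma2 * sigma1 * sigma2 := by
  have h := PresentedGroup.one_of_mem (rels := braidRels) (Set.mem_singleton _)
  rw [map_mul, map_inv, mul_inv_eq_one] at h
  simp only [map_mul] at h
  exact h

/-- Induction principle for the braid group. -/
theorem braidGroup3_induction {p : BraidGroup3 → Prop} (h1 : p sigma1) (h2 : p sigma2)
    (one : p 1) (mul : ∀ x y, p x → p y → p (x * y)) (inv : ∀ x, p x → p x⁻¹) (g : BraidGroup3) :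
    p g := by
  have hg : g ∈ Subgroup.closure (Set.range (PresentedGroup.of (rels := braidRels))) := by
    simp
  induction hg using Subgroup.closure_induction with
  | mem x hx =>
    obtain ⟨i, rfl⟩ := hx
    fin_cases i
    · exact h1
    · exact h2
  | one => exact one
  | mul x y _ _ hx hy => exact mul x y hx hy
  | inv x _ hx => exact inv x hx

/-! ### Invariant subspaces, Schur's lemma and the half and third twists -/

section EndAlgebra

variable {V : Type*} [AddCommGroup V] [Module ℂ V]

theorem jointlyIrreducible_of_isIrreducible [FiniteDimensional ℂ V] (ρ : Representation ℂ BraidGroup3 V)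
    (hρ : ρ.IsIrreducible) : JointlyIrreducible (ρ sigma1) (ρ sigma2) := by
  intro W h1 h2
  have key : ∀ g, ∀ x ∈ W, ρ g x ∈ W := by
    intro g
    induction g using braidGroup3_induction with
    | h1 => exact h1
    | h2 => exact h2
    | one => simp
    | mul x y hx hy => intro v hv; rw [map_mul]; exact hx _ (hy _ hv)
    | inv g hg =>
      intro v hv
      have hinj : Function.Injective (ρ g) := fun x y hxy => by
        simpa using congrArg (ρ g⁻¹) hxy
      have hmap : W.map (ρ g) = W := by
        apply Submodule.eq_of_le_of_finrank_eq
        · rintro _ ⟨x, hx, rfl⟩; exact hg x hx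
        · exact (Submodule.equivMapOfInjective _ hinj W).finrank_eq.symm
      rw [← hmap] at hv
      obtain ⟨w, hw, rfl⟩ := hv
      simpa using hw
  let U : Subrepresentation ρ := ⟨W, fun g x hx => key g x hx⟩
  rcases hρ.eq_bot_or_eq_top U with h | h
  · left; exact congrArg Subrepresentation.toSubmodule h
  · right; exact congrArg Subrepresentation.toSubmodule h

/-- Schur's lemma for a pair of operators. -/
theorem JointlyIrreducible.exists_eq_smul_one [FiniteDimensional ℂ V] [Nontrivial V] {A B Z : Module.End ℂ V}
    (h : JointlyIrreducible A B) (hA : A * Z = Z * A) (hB : B * Z = Z * B) :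
    ∃ c : ℂ, Z = c • 1 := by
  obtain ⟨c, hc⟩ := Module.End.exists_eigenvalue Z
  refine ⟨c, ?_⟩
  have inv : ∀ C : Module.End ℂ V, C * Z = Z * C →
      ∀ x ∈ Z.eigenspace c, C x ∈ Z.eigenspace c := by
    intro C hC x hx
    rw [Module.End.mem_eigenspace_iff] at hx ⊢
    rw [← Module.End.mul_apply, ← hC, Module.End.mul_apply, hx, map_smul]
  rcases h _ (inv A hA) (inv B hB) with h0 | h0
  · exact absurd h0 hc
  · ext x
    have : x ∈ Z.eigenspace c := h0 ▸ Submodule.mem_top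
    simpa using Module.End.mem_eigenspace_iff.mp this

namespace IsBraidPair

variable {A B : Module.End ℂ V} {c : ℂ}

theorem mul_cube (h : IsBraidPair A B c) : A * B * (A * B) * (A * B) = c • 1 := by
  have h1 : A * B * (A * B) * (A * B) = (A * B * A) * (B * A * B) := by noncomm_ring
  rw [h1, ← h.braid, h.sq]

theorem smul_left (h : IsBraidPair A B c) : c • A = A * B * (A * B) * (A * B * A) := by
  have := congrArg (· * A) h.mul_cube
  simp only [smul_mul_assoc, one_mul] at this
  rw [← this]
  noncomm_ring

/-- The half twist carries A to B; determinants and eigenprojections are transported along it. -/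
theorem semiconj (h : IsBraidPair A B c) : A * B * A * A = B * (A * B * A) := by
  nth_rewrite 1 [h.braid]
  noncomm_ring

theorem smul_right (h : IsBraidPair A B c) : c • B = A * B * A * (A * B * (A * B)) := by
  have h1 : A * B * A * (A * B * (A * B)) = (A * B * A * A) * (B * A * B) := by noncomm_ring
  rw [h1, ← h.braid, h.semiconj, mul_assoc, h.sq]
  simp

/-- A subspace invariant under `A B A` and `A B` is trivial. -/
theorem eq_bot_or_eq_top (h : IsBraidPair A B c) (hirr : JointlyIrreducible A B)
    (W : Submodule ℂ V) (hS : ∀ x ∈ W, (A * B * A) x ∈ W) (hT : ∀ x ∈ W, (A * B) x ∈ W) :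
    W = ⊥ ∨ W = ⊤ := by
  apply hirr W
  · intro x hx
    rw [← W.smul_mem_iff h.ne_zero, ← LinearMap.smul_apply, h.smul_left]
    exact hT _ (hT _ (hS _ hx))
  · intro x hx
    rw [← W.smul_mem_iff h.ne_zero, ← LinearMap.smul_apply, h.smul_right]
    exact hS _ (hT _ (hT _ hx))

/-- A common eigenvector of the two twists spans an invariant line, which is impossible in dimension
at least two; hence the eigenspaces meet trivially. -/
theorem finrank_eigenspace_add_le [FiniteDimensional ℂ V] (h : IsBraidPair A B c) (hirr : JointlyIrreducible A B)
    (hd : 2 ≤ Module.finrank ℂ V) (z w : ℂ) :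
    Module.finrank ℂ ((A * B * A).eigenspace z) + Module.finrank ℂ ((A * B).eigenspace w) ≤
      Module.finrank ℂ V := by
  apply Submodule.finrank_add_finrank_le_of_disjoint
  rw [Submodule.disjoint_def]
  intro x hx hx'
  rw [Module.End.mem_eigenspace_iff] at hx hx'
  have inv : ∀ (C : Module.End ℂ V) (u : ℂ), C x = u • x → ∀ y ∈ ℂ ∙ x, C y ∈ ℂ ∙ x := by
    intro C u hu y hy
    obtain ⟨r, rfl⟩ := Submodule.mem_span_singleton.mp hy
    rw [map_smul, hu]
    exact Submodule.smul_mem _ _ (Submodule.smul_mem _ _ (Submodule.mem_span_singleton_self x))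
  rcases h.eq_bot_or_eq_top hirr _ (inv _ z hx) (inv _ w hx') with h0 | h0
  · simpa using h0
  · have h1 := finrank_span_le_card (R := ℂ) ({x} : Set V)
    rw [h0, finrank_top] at h1
    simp only [Set.toFinset_singleton, Finset.card_singleton] at h1
    omega

/-- In dimension at least three, `A B` is not annihilated by a quadratic polynomial. -/
theorem finrank_le_two_of_quadratic [FiniteDimensional ℂ V] [Nontrivial V] (h : IsBraidPair A B c)
    (hirr : JointlyIrreducible A B) (α β : ℂ) (hq : A * B * (A * B) = α • (A * B) + β • 1) :
    Module.finrank ℂ V ≤ 2 := by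
  obtain ⟨l, hl⟩ := Module.End.exists_eigenvalue A
  obtain ⟨x, hx⟩ := hl.exists_hasEigenvector
  have hAx : A x = l • x := hx.apply_eq_smul
  have hx0 : x ≠ 0 := hx.2
  have hSx : (A * B * A) x = l • (A * B) x := by
    rw [Module.End.mul_apply, hAx, map_smul]
  have hl0 : l ≠ 0 := by
    rintro rfl
    have h1 := congrArg (· x) h.sq
    simp only [Module.End.mul_apply (A * B * A), hSx] at h1
    rw [zero_smul, map_zero, LinearMap.smul_apply, Module.End.one_apply] at h1
    exact smul_ne_zero h.ne_zero hx0 h1.symm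
  have hSTx : (A * B * A) ((A * B) x) = (l⁻¹ * c) • x := by
    have h1 : (A * B * A) ((A * B * A) x) = c • x := by
      rw [← Module.End.mul_apply, h.sq]; simp
    rw [hSx, map_smul] at h1
    rw [mul_smul, ← h1, smul_smul, inv_mul_cancel₀ hl0, one_smul]
  have hTTx : (A * B) ((A * B) x) = α • (A * B) x + β • x := by
    rw [← Module.End.mul_apply, hq]; simp
  -- The span of x and y is invariant: S x is a multiple of y, S² = c returns y to a multiple of x,
  -- and the quadratic relation controls T y.
  set y := (A * B) x with hy
  have memx : x ∈ Submodule.span ℂ {x, y} := Submodule.subset_span (by simp)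
  have memy : y ∈ Submodule.span ℂ {x, y} := Submodule.subset_span (by simp)
  have inv : ∀ C : Module.End ℂ V, C x ∈ Submodule.span ℂ {x, y} →
      C y ∈ Submodule.span ℂ {x, y} →
      ∀ z ∈ Submodule.span ℂ {x, y}, C z ∈ Submodule.span ℂ {x, y} := by
    intro C h1 h2 z hz
    obtain ⟨r, s, rfl⟩ := Submodule.mem_span_pair.mp hz
    rw [map_add, map_smul, map_smul]
    exact add_mem (Submodule.smul_mem _ _ h1) (Submodule.smul_mem _ _ h2)
  rcases h.eq_bot_or_eq_top hirr (Submodule.span ℂ {x, y})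
    (inv _ (hSx ▸ Submodule.smul_mem _ _ memy) (hSTx ▸ Submodule.smul_mem _ _ memx))
    (inv _ memy (hTTx ▸ add_mem (Submodule.smul_mem _ _ memy) (Submodule.smul_mem _ _ memx)))
    with h0 | h0
  · rw [h0] at memx
    exact absurd (by simpa using memx) hx0
  · classical
    have h1 := finrank_span_finset_le_card (R := ℂ) ({x, y} : Finset V)
    rw [Finset.coe_pair, Set.finrank, h0, finrank_top] at h1
    exact h1.trans Finset.card_le_two

end IsBraidPair

/-- Trace of powers and determinant of a diagonalizable operator with spectrum in `Z`. -/
theorem trace_pow_det_of_aeval_eq_zero [FiniteDimensional ℂ V] (f : Module.End ℂ V) (Z : Finset ℂ)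
    (hf : Polynomial.aeval f (∏ z ∈ Z, (Polynomial.X - Polynomial.C z)) = 0) :
    (∀ k : ℕ, LinearMap.trace ℂ V (f ^ k) =
      ∑ z ∈ Z, (Module.finrank ℂ (f.eigenspace z) : ℂ) * z ^ k) ∧
    LinearMap.det f = ∏ z ∈ Z, z ^ Module.finrank ℂ (f.eigenspace z) ∧
    Module.finrank ℂ V = ∑ z ∈ Z, Module.finrank ℂ (f.eigenspace z) := by
  classical
  have hss : f.IsSemisimple := by
    refine Module.End.isSemisimple_of_squarefree_aeval_eq_zero ?_ hf
    exact (Polynomial.separable_prod_X_sub_C_iff'.mpr fun _ _ _ _ h => h).squarefree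
  have hbot : ∀ z ∉ Z, f.eigenspace z = ⊥ := by
    intro z hz
    rw [eq_bot_iff]
    intro x hx
    have h1 := Module.End.aeval_apply_of_mem_apply_eq_smul
      (p := ∏ z ∈ Z, (Polynomial.X - Polynomial.C z)) (Module.End.mem_eigenspace_iff.mp hx)
    rw [hf, Polynomial.eval_prod] at h1
    simp only [Polynomial.eval_sub, Polynomial.eval_X, Polynomial.eval_C, LinearMap.zero_apply]
      at h1
    rcases smul_eq_zero.mp h1.symm with h2 | h2
    · obtain ⟨w, hw, hzw⟩ := Finset.prod_eq_zero_iff.mp h2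
      exact absurd (sub_eq_zero.mp hzw ▸ hw) hz
    · simpa using h2
  have hint : DirectSum.IsInternal fun z : Z => f.eigenspace (z : ℂ) := by
    apply DirectSum.isInternal_submodule_of_iSupIndep_of_iSup_eq_top
    · exact f.eigenspaces_iSupIndep.comp Subtype.coe_injective
    · rw [eq_top_iff, ← hss.iSup_eigenspace_eq_top]
      refine iSup_le fun z => ?_
      by_cases hz : z ∈ Z
      · exact le_iSup (fun z : Z => f.eigenspace (z : ℂ)) ⟨z, hz⟩
      · rw [hbot z hz]; exact bot_le
  let b := hint.collectedBasis fun z => Module.finBasis ℂ (f.eigenspace (z : ℂ))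
  have hb : ∀ i, f (b i) = (i.1 : ℂ) • b i := fun i =>
    Module.End.mem_eigenspace_iff.mp (hint.collectedBasis_mem _ i)
  have hpow : ∀ k : ℕ, LinearMap.toMatrix b b (f ^ k) =
      Matrix.diagonal fun i => (i.1 : ℂ) ^ k := by
    intro k
    have hbk : ∀ i, (f ^ k) (b i) = (i.1 : ℂ) ^ k • b i := by
      intro i
      induction k with
      | zero => simp
      | succ k ih => rw [pow_succ', Module.End.mul_apply, ih, map_smul, hb, smul_smul, pow_succ]
    ext i j
    rw [LinearMap.toMatrix_apply, hbk, map_smul]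
    by_cases hij : i = j
    · subst hij; simp
    · simp [hij]
  refine ⟨fun k => ?_, ?_, ?_⟩
  · rw [LinearMap.trace_eq_matrix_trace ℂ b, hpow, Matrix.trace_diagonal, Fintype.sum_sigma]
    simpa using Finset.sum_coe_sort Z fun z => (Module.finrank ℂ (f.eigenspace z) : ℂ) * z ^ k
  · have h1 := hpow 1
    rw [pow_one] at h1
    rw [← LinearMap.det_toMatrix b, h1, Matrix.det_diagonal, Fintype.prod_sigma]
    simpa using Finset.prod_coe_sort Z fun z => z ^ Module.finrank ℂ (f.eigenspace z)
  · rw [Module.finrank_eq_card_basis b, Fintype.card_sigma]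
    simpa using Finset.sum_coe_sort Z fun z => Module.finrank ℂ (f.eigenspace z)

end EndAlgebra

/-! ### Eigenvalue multiplicities and traces of the twists -/

theorem cube_eq_one_of_sq_add {ω : ℂ} (hω : ω ^ 2 + ω + 1 = 0) : ω ^ 3 = 1 := by
  linear_combination (ω - 1) * hω

theorem pow_eq_one_iff_three_dvd {ω : ℂ} (hω : ω ^ 2 + ω + 1 = 0) (n : ℕ) :
    ω ^ n = 1 ↔ 3 ∣ n := by
  have h3 := cube_eq_one_of_sq_add hω
  have h1 : ω ≠ 1 := by rintro rfl; norm_num at hω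
  rw [← orderOf_dvd_iff_pow_eq_one]
  have h2 : orderOf ω = 3 := orderOf_eq_prime h3 h1
  rw [h2]

namespace IsBraidPair

variable {V : Type*} [AddCommGroup V] [Module ℂ V] [FiniteDimensional ℂ V]
  {A B : Module.End ℂ V} {c : ℂ}

/-- The operator `A B A` has at most the two eigenvalues `±ε`, where `ε² = c`. -/
theorem half_twist_spectrum (h : IsBraidPair A B c) {ε : ℂ} (hε : ε ^ 2 = c) {n₀ n₁ : ℕ}
    (h₀ : n₀ = Module.finrank ℂ ((A * B * A).eigenspace ε))
    (h₁ : n₁ = Module.finrank ℂ ((A * B * A).eigenspace (-ε))) :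
    n₀ + n₁ = Module.finrank ℂ V ∧
    LinearMap.trace ℂ V (A * B * A) = ((n₀ : ℂ) - n₁) * ε ∧
    LinearMap.det (A * B * A) = ε ^ Module.finrank ℂ V * (-1) ^ n₁ := by
  have hε0 : ε ≠ 0 := by rintro rfl; exact h.ne_zero (by simpa using hε.symm)
  have hne : ε ≠ -ε := fun h0 => hε0 (self_eq_neg.mp h0)
  obtain ⟨ht, hd, hr⟩ := trace_pow_det_of_aeval_eq_zero (A * B * A) {ε, -ε} (by
    rw [Finset.prod_pair hne, show (Polynomial.X - Polynomial.C ε) *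
      (Polynomial.X - Polynomial.C (-ε)) = Polynomial.X * Polynomial.X - Polynomial.C c by
        rw [← hε]; simp only [map_neg, map_pow]; ring]
    rw [map_sub, map_mul, Polynomial.aeval_X, Polynomial.aeval_C, h.sq,
      Algebra.algebraMap_eq_smul_one, sub_self])
  have ht1 := ht 1
  rw [Finset.sum_pair hne, ← h₀, ← h₁] at hr ht1
  rw [Finset.prod_pair hne, ← h₀, ← h₁] at hd
  refine ⟨hr.symm, ?_, ?_⟩
  · rw [pow_one] at ht1
    rw [ht1]; ring
  · rw [hd, hr, neg_pow, pow_add]; ring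

/-- The operator `A B` has at most the three eigenvalues `τ, τω, τω²`, where `τ³ = c`. -/
theorem third_twist_spectrum (h : IsBraidPair A B c) {τ ω : ℂ} (hτ : τ ^ 3 = c)
    (hω : ω ^ 2 + ω + 1 = 0) {m₀ m₁ m₂ : ℕ}
    (h₀ : m₀ = Module.finrank ℂ ((A * B).eigenspace τ))
    (h₁ : m₁ = Module.finrank ℂ ((A * B).eigenspace (τ * ω)))
    (h₂ : m₂ = Module.finrank ℂ ((A * B).eigenspace (τ * ω ^ 2))) :
    m₀ + m₁ + m₂ = Module.finrank ℂ V ∧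
    LinearMap.trace ℂ V (A * B) = τ * (m₀ + m₁ * ω + m₂ * ω ^ 2) ∧
    LinearMap.trace ℂ V (A * B * (A * B)) = τ ^ 2 * (m₀ + m₁ * ω ^ 2 + m₂ * ω) ∧
    LinearMap.det (A * B) = τ ^ Module.finrank ℂ V * ω ^ (m₁ + 2 * m₂) := by
  have h3 := cube_eq_one_of_sq_add hω
  have hτ0 : τ ≠ 0 := by rintro rfl; exact h.ne_zero (by simpa using hτ.symm)
  have hω1 : ω ≠ 1 := by rintro rfl; norm_num at hω
  have hω0 : ω ≠ 0 := by rintro rfl; norm_num at hω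
  have hn1 : τ ≠ τ * ω := fun h0 => hω1 (by simpa [hτ0] using h0)
  have hn2 : τ ≠ τ * ω ^ 2 := fun h0 => by
    have h1 : ω ^ 2 = 1 := by simpa [hτ0] using h0
    rw [pow_eq_one_iff_three_dvd hω] at h1
    omega
  have hn3 : τ * ω ≠ τ * ω ^ 2 := fun h0 => hω1 (by
    have h1 := mul_left_cancel₀ hτ0 h0
    rw [pow_two] at h1
    exact (mul_left_cancel₀ hω0 ((mul_one ω).trans h1)).symm)
  have hnot : τ ∉ ({τ * ω, τ * ω ^ 2} : Finset ℂ) := by simp [hn1, hn2]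
  obtain ⟨ht, hd, hr⟩ := trace_pow_det_of_aeval_eq_zero (A * B) {τ, τ * ω, τ * ω ^ 2} (by
    rw [Finset.prod_insert hnot, Finset.prod_pair hn3, show (Polynomial.X - Polynomial.C τ) *
      ((Polynomial.X - Polynomial.C (τ * ω)) * (Polynomial.X - Polynomial.C (τ * ω ^ 2))) =
        Polynomial.X * Polynomial.X * Polynomial.X - Polynomial.C c by
        have e1 : (Polynomial.C ω) ^ 2 + Polynomial.C ω + 1 = 0 := by
          rw [← Polynomial.C_pow, ← Polynomial.C_add, ← Polynomial.C_1, ← Polynomial.C_add, hω,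
            Polynomial.C_0]
        rw [← hτ]; simp only [map_mul, map_pow]
        linear_combination (-Polynomial.C τ * Polynomial.X ^ 2
          + (Polynomial.C τ) ^ 2 * Polynomial.C ω * Polynomial.X
          - (Polynomial.C τ) ^ 3 * (Polynomial.C ω - 1)) * e1]
    rw [map_sub, map_mul, map_mul, Polynomial.aeval_X, Polynomial.aeval_C, h.mul_cube,
      Algebra.algebraMap_eq_smul_one, sub_self])
  have ht1 := ht 1
  have ht2 := ht 2
  rw [Finset.sum_insert hnot, Finset.sum_pair hn3, ← h₀, ← h₁, ← h₂] at hr ht1 ht2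
  rw [Finset.prod_insert hnot, Finset.prod_pair hn3, ← h₀, ← h₁, ← h₂] at hd
  refine ⟨by omega, ?_, ?_, ?_⟩
  · rw [pow_one] at ht1
    rw [ht1]; ring
  · rw [pow_two] at ht2
    rw [ht2]
    linear_combination τ ^ 2 * (m₂ : ℂ) * ω * h3
  · rw [hd, hr]; ring

/-- In dimension at least three, all three cube roots of `c` are eigenvalues of `A B`. -/
theorem finrank_eigenspace_pos (h : IsBraidPair A B c) (hirr : JointlyIrreducible A B)
    (hd : 3 ≤ Module.finrank ℂ V) {τ : ℂ} (hτ : τ ^ 3 = c) :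
    0 < Module.finrank ℂ ((A * B).eigenspace τ) := by
  have : Nontrivial V := Module.nontrivial_of_finrank_pos (R := ℂ) (by omega)
  by_contra h0
  have hbot : (A * B).eigenspace τ = ⊥ := by
    rw [← Submodule.finrank_eq_zero (R := ℂ)]; omega
  have hinj : Function.Injective ((A * B) - τ • (1 : Module.End ℂ V)) := by
    rw [← LinearMap.ker_eq_bot, ← hbot, Module.End.eigenspace_def]
  -- When T − τ is injective it cancels from T³ − τ³ = (T − τ)(T² + τT + τ²).
  have hq : A * B * (A * B) = (-τ) • (A * B) + (-τ ^ 2) • 1 := by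
    have h1 : ((A * B) - τ • (1 : Module.End ℂ V)) *
        (A * B * (A * B) + τ • (A * B) + τ ^ 2 • 1) = 0 := by
      have h2 : ((A * B) - τ • (1 : Module.End ℂ V)) *
        (A * B * (A * B) + τ • (A * B) + τ ^ 2 • 1) =
          A * B * (A * B) * (A * B) - τ ^ 3 • 1 := by
        generalize A * B = T
        simp only [sub_mul, mul_add, mul_smul_comm, smul_mul_assoc, one_mul, mul_one]
        module
      rw [h2, h.mul_cube, hτ, sub_self]
    have h3 : A * B * (A * B) + τ • (A * B) + τ ^ 2 • (1 : Module.End ℂ V) = 0 := by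
      ext x
      apply hinj
      rw [← Module.End.mul_apply, h1]
      simp
    rw [neg_smul, neg_smul, ← neg_add, ← sub_eq_zero, sub_neg_eq_add, ← h3, add_assoc]
  have := h.finrank_le_two_of_quadratic hirr _ _ hq
  omega

end IsBraidPair

theorem exists_sq_add_self_add_one_eq_zero : ∃ ω : ℂ, ω ^ 2 + ω + 1 = 0 := by
  obtain ⟨s, hs⟩ := IsAlgClosed.exists_pow_nat_eq (-3 : ℂ) (n := 2) (by norm_num)
  exact ⟨(s - 1) / 2, by linear_combination hs / 4⟩

namespace IsBraidPair

variable {V : Type*} [AddCommGroup V] [Module ℂ V] [FiniteDimensional ℂ V]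
  {A B : Module.End ℂ V} {c : ℂ}

theorem det_half_twist_ne_zero (h : IsBraidPair A B c) : LinearMap.det (A * B * A) ≠ 0 := by
  intro h0
  have h1 := congrArg LinearMap.det h.sq
  rw [map_mul, h0, LinearMap.det_smul, map_one, mul_one, mul_zero] at h1
  exact pow_ne_zero _ h.ne_zero h1.symm

theorem det_left_ne_zero (h : IsBraidPair A B c) : LinearMap.det A ≠ 0 := by
  have h1 := h.det_half_twist_ne_zero
  rw [map_mul] at h1
  exact right_ne_zero_of_mul h1

theorem det_right (h : IsBraidPair A B c) : LinearMap.det B = LinearMap.det A := by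
  have h1 := congrArg LinearMap.det h.semiconj
  rw [map_mul, map_mul LinearMap.det B, mul_comm] at h1
  exact (mul_right_cancel₀ h.det_half_twist_ne_zero h1).symm

theorem det_third_twist (h : IsBraidPair A B c) :
    LinearMap.det (A * B) = LinearMap.det A ^ 2 := by
  rw [map_mul, h.det_right, pow_two]

theorem det_half_twist (h : IsBraidPair A B c) :
    LinearMap.det (A * B * A) = LinearMap.det A ^ 3 := by
  rw [map_mul, h.det_third_twist, ← pow_succ]

theorem scalar_pow_finrank (h : IsBraidPair A B c) :
    c ^ Module.finrank ℂ V = LinearMap.det A ^ 6 := by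
  have h1 := congrArg LinearMap.det h.sq
  rw [map_mul, h.det_half_twist, LinearMap.det_smul, map_one, mul_one] at h1
  rw [← h1]; ring

/-- T has an eigenvector, so no eigenspace of S is all of V; both signs are simple and det S = Δ³
gives c. With τ = −Δ, det T = Δ² makes m₁ + 2m₂ divisible by 3, and m_i ≤ 1 leaves (0, 1, 1). -/
theorem traces_two (h : IsBraidPair A B c) (hirr : JointlyIrreducible A B)
    (hd : Module.finrank ℂ V = 2) {Δ : ℂ} (hΔ : LinearMap.det A = Δ) :
    c = -Δ ^ 3 ∧ LinearMap.trace ℂ V (A * B) = Δ ∧ LinearMap.trace ℂ V (A * B * A) = 0 ∧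
      LinearMap.trace ℂ V (A * B * (A * B)) = -Δ ^ 2 := by
  obtain ⟨ε, hε⟩ := IsAlgClosed.exists_pow_nat_eq c (n := 2) (by norm_num)
  obtain ⟨ω, hω⟩ := exists_sq_add_self_add_one_eq_zero
  obtain ⟨hn, hS, hdS⟩ := h.half_twist_spectrum hε rfl rfl
  have hle := fun z w => h.finrank_eigenspace_add_le hirr (by omega) z w
  have l0 := fun w => hle ε w
  have l1 := fun w => hle (-ε) w
  generalize Module.finrank ℂ ((A * B * A).eigenspace ε) = n₀ at *
  generalize Module.finrank ℂ ((A * B * A).eigenspace (-ε)) = n₁ at *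
  rw [h.det_half_twist, hΔ, hd] at hdS
  have hn1 : n₁ = 1 := by
    have e : ∀ τ ω : ℂ, τ ^ 3 = c → ω ^ 2 + ω + 1 = 0 → n₁ = 1 := by
      intro τ ω hτ hω
      obtain ⟨hm, -, -, -⟩ := h.third_twist_spectrum hτ hω rfl rfl rfl
      have := l0 τ; have := l0 (τ * ω); have := l0 (τ * ω ^ 2)
      have := l1 τ; have := l1 (τ * ω); have := l1 (τ * ω ^ 2)
      omega
    obtain ⟨τ, hτ⟩ := IsAlgClosed.exists_pow_nat_eq c (n := 3) (by norm_num)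
    exact e τ ω hτ hω
  have hn0 : n₀ = 1 := by omega
  subst hn1 hn0
  have hc : c = -Δ ^ 3 := by rw [hdS, ← hε]; ring
  obtain ⟨hm, hT, hTT, hdT⟩ := h.third_twist_spectrum (τ := -Δ) (by rw [hc]; ring) hω rfl rfl rfl
  have b0 := l0 (-Δ); have b1 := l0 (-Δ * ω); have b2 := l0 (-Δ * ω ^ 2)
  generalize Module.finrank ℂ ((A * B).eigenspace (-Δ)) = m₀ at *
  generalize Module.finrank ℂ ((A * B).eigenspace (-Δ * ω)) = m₁ at *
  generalize Module.finrank ℂ ((A * B).eigenspace (-Δ * ω ^ 2)) = m₂ at *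
  have hΔ0 : Δ ≠ 0 := hΔ ▸ h.det_left_ne_zero
  rw [h.det_third_twist, hΔ, hd, neg_sq, left_eq_mul₀ (pow_ne_zero _ hΔ0),
    pow_eq_one_iff_three_dvd hω] at hdT
  obtain ⟨rfl, rfl, rfl⟩ : m₀ = 0 ∧ m₁ = 1 ∧ m₂ = 1 := by omega
  refine ⟨hc, ?_, ?_, ?_⟩
  · rw [hT]; push_cast; linear_combination (-Δ) * hω
  · rw [hS]; push_cast; ring
  · rw [hTT]; push_cast; linear_combination Δ ^ 2 * hω

/-- All three cube roots occur, so each is simple and det T gives c = Δ². Taking ε = Δ, det S makes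
the multiplicity of −Δ even, and neither sign exceeds 2. -/
theorem traces_three (h : IsBraidPair A B c) (hirr : JointlyIrreducible A B)
    (hd : Module.finrank ℂ V = 3) {Δ : ℂ} (hΔ : LinearMap.det A = Δ) :
    c = Δ ^ 2 ∧ LinearMap.trace ℂ V (A * B) = 0 ∧ LinearMap.trace ℂ V (A * B * A) = -Δ ∧
      LinearMap.trace ℂ V (A * B * (A * B)) = 0 := by
  obtain ⟨τ, hτ⟩ := IsAlgClosed.exists_pow_nat_eq c (n := 3) (by norm_num)
  obtain ⟨ω, hω⟩ := exists_sq_add_self_add_one_eq_zero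
  have h3 := cube_eq_one_of_sq_add hω
  obtain ⟨hm, hT, hTT, hdT⟩ := h.third_twist_spectrum hτ hω rfl rfl rfl
  have p0 := h.finrank_eigenspace_pos hirr (by omega) hτ
  have p1 := h.finrank_eigenspace_pos hirr (by omega) (τ := τ * ω) (by rw [mul_pow, h3, hτ, mul_one])
  have p2 := h.finrank_eigenspace_pos hirr (by omega) (τ := τ * ω ^ 2)
    (by rw [mul_pow, ← pow_mul, mul_comm 2 3, pow_mul, h3, hτ, one_pow, mul_one])
  have hle := fun z => h.finrank_eigenspace_add_le hirr (by omega) z τ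
  generalize Module.finrank ℂ ((A * B).eigenspace τ) = m₀ at *
  generalize Module.finrank ℂ ((A * B).eigenspace (τ * ω)) = m₁ at *
  generalize Module.finrank ℂ ((A * B).eigenspace (τ * ω ^ 2)) = m₂ at *
  obtain ⟨rfl, rfl, rfl⟩ : m₀ = 1 ∧ m₁ = 1 ∧ m₂ = 1 := by omega
  have hc : c = Δ ^ 2 := by
    rw [← hΔ, ← h.det_third_twist, hdT, hd, hτ, h3, mul_one]
  obtain ⟨hn, hS, hdS⟩ := h.half_twist_spectrum hc.symm rfl rfl
  have l0 := hle Δ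
  have l1 := hle (-Δ)
  generalize Module.finrank ℂ ((A * B * A).eigenspace Δ) = n₀ at *
  generalize Module.finrank ℂ ((A * B * A).eigenspace (-Δ)) = n₁ at *
  have hΔ0 : Δ ≠ 0 := hΔ ▸ h.det_left_ne_zero
  rw [h.det_half_twist, hΔ, hd, left_eq_mul₀ (pow_ne_zero _ hΔ0),
    neg_one_pow_eq_one_iff_even (by norm_num)] at hdS
  obtain ⟨k, hk⟩ := hdS
  obtain ⟨rfl, rfl⟩ : n₀ = 1 ∧ n₁ = 2 := by omega
  refine ⟨hc, ?_, ?_, ?_⟩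
  · rw [hT]; push_cast; linear_combination τ * hω
  · rw [hS]; push_cast; ring
  · rw [hTT]; push_cast; linear_combination τ ^ 2 * hω

/-- Some eigenspace of T has dimension at least 2, so both signs of S have multiplicity 2 and c² =
Δ³. This makes γ = −c/Δ a square root of Δ with c = −γ³. For τ = −γ, divisibility by 3 leaves (2, 1,
1) and (0, 2, 2); the latter omits a cube root. -/
theorem traces_four (h : IsBraidPair A B c) (hirr : JointlyIrreducible A B)
    (hd : Module.finrank ℂ V = 4) {Δ : ℂ} (hΔ : LinearMap.det A = Δ) :
    ∃ γ : ℂ, γ ^ 2 = Δ ∧ c = -γ ^ 3 ∧ LinearMap.trace ℂ V (A * B) = -γ ∧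
      LinearMap.trace ℂ V (A * B * A) = 0 ∧
      LinearMap.trace ℂ V (A * B * (A * B)) = γ ^ 2 := by
  obtain ⟨ε, hε⟩ := IsAlgClosed.exists_pow_nat_eq c (n := 2) (by norm_num)
  obtain ⟨ω, hω⟩ := exists_sq_add_self_add_one_eq_zero
  have h3 := cube_eq_one_of_sq_add hω
  obtain ⟨hn, hS, hdS⟩ := h.half_twist_spectrum hε rfl rfl
  have l0 := fun w => h.finrank_eigenspace_add_le hirr (by omega) ε w
  have l1 := fun w => h.finrank_eigenspace_add_le hirr (by omega) (-ε) w
  generalize Module.finrank ℂ ((A * B * A).eigenspace ε) = n₀ at *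
  generalize Module.finrank ℂ ((A * B * A).eigenspace (-ε)) = n₁ at *
  have mult : ∀ τ : ℂ, τ ^ 3 = c → n₀ = 2 ∧ n₁ = 2 := by
    intro τ hτ
    obtain ⟨hm, -, -, -⟩ := h.third_twist_spectrum hτ hω rfl rfl rfl
    have := l0 τ; have := l0 (τ * ω); have := l0 (τ * ω ^ 2)
    have := l1 τ; have := l1 (τ * ω); have := l1 (τ * ω ^ 2)
    omega
  obtain ⟨hn0, hn1⟩ : n₀ = 2 ∧ n₁ = 2 := by
    obtain ⟨τ, hτ⟩ := IsAlgClosed.exists_pow_nat_eq c (n := 3) (by norm_num)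
    exact mult τ hτ
  subst hn0 hn1
  have hΔ0 : Δ ≠ 0 := hΔ ▸ h.det_left_ne_zero
  have hc0 := h.ne_zero
  have hc2 : c ^ 2 = Δ ^ 3 := by
    rw [← hΔ, ← h.det_half_twist, hdS, hd, ← hε]; ring
  have hγ2 : (-c / Δ) ^ 2 = Δ := by
    field_simp; linear_combination hc2
  have hγ3 : c = -(-c / Δ) ^ 3 := by
    rw [pow_succ, hγ2]; field_simp
  refine ⟨-c / Δ, hγ2, hγ3, ?_⟩
  generalize -c / Δ = γ at *
  have hτ : (-γ) ^ 3 = c := by rw [hγ3]; ring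
  obtain ⟨hm, hT, hTT, hdT⟩ := h.third_twist_spectrum hτ hω rfl rfl rfl
  have p0 := h.finrank_eigenspace_pos hirr (by omega) hτ
  have b0 := l0 (-γ); have b1 := l0 (-γ * ω); have b2 := l0 (-γ * ω ^ 2)
  generalize Module.finrank ℂ ((A * B).eigenspace (-γ)) = m₀ at *
  generalize Module.finrank ℂ ((A * B).eigenspace (-γ * ω)) = m₁ at *
  generalize Module.finrank ℂ ((A * B).eigenspace (-γ * ω ^ 2)) = m₂ at *
  rw [h.det_third_twist, hΔ, hd, show (-γ) ^ 4 = Δ ^ 2 by rw [← hγ2]; ring,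
    left_eq_mul₀ (pow_ne_zero _ hΔ0), pow_eq_one_iff_three_dvd hω] at hdT
  obtain ⟨rfl, rfl, rfl⟩ : m₀ = 2 ∧ m₁ = 1 ∧ m₂ = 1 := by omega
  refine ⟨?_, ?_, ?_⟩
  · rw [hT]; push_cast; linear_combination (-γ) * hω
  · rw [hS]; push_cast; ring
  · rw [hTT]; push_cast; linear_combination γ ^ 2 * hω

/-- Taking determinants of S² = c gives c⁵ = Δ⁶, so γ = c/Δ satisfies γ⁵ = Δ and c = γ⁶.
Multiplicities are at most 3 for S and at most 2 for T; parity in det S and divisibility by 3 in det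
T then select (3, 2) and (1, 2, 2). -/
theorem traces_five (h : IsBraidPair A B c) (hirr : JointlyIrreducible A B)
    (hd : Module.finrank ℂ V = 5) {Δ : ℂ} (hΔ : LinearMap.det A = Δ) :
    ∃ γ : ℂ, γ ^ 5 = Δ ∧ c = γ ^ 6 ∧ LinearMap.trace ℂ V (A * B) = -γ ^ 2 ∧
      LinearMap.trace ℂ V (A * B * A) = γ ^ 3 ∧
      LinearMap.trace ℂ V (A * B * (A * B)) = -γ ^ 4 := by
  obtain ⟨ω, hω⟩ := exists_sq_add_self_add_one_eq_zero
  have hΔ0 : Δ ≠ 0 := hΔ ▸ h.det_left_ne_zero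
  have hc5 := h.scalar_pow_finrank
  rw [hd, hΔ] at hc5
  have hγ5 : (c / Δ) ^ 5 = Δ := by
    field_simp; linear_combination hc5
  have hγ6 : c = (c / Δ) ^ 6 := by
    rw [pow_succ, hγ5]; field_simp
  refine ⟨c / Δ, hγ5, hγ6, ?_⟩
  generalize c / Δ = γ at *
  obtain ⟨hn, hS, hdS⟩ := h.half_twist_spectrum (ε := γ ^ 3) (by rw [hγ6]; ring) rfl rfl
  obtain ⟨hm, hT, hTT, hdT⟩ := h.third_twist_spectrum (τ := γ ^ 2) (by rw [hγ6]; ring) hω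
    rfl rfl rfl
  have hle := fun z w => h.finrank_eigenspace_add_le hirr (by omega) z w
  have a0 := hle (γ ^ 3) (γ ^ 2)
  have a1 := hle (γ ^ 3) (γ ^ 2 * ω)
  have a2 := hle (γ ^ 3) (γ ^ 2 * ω ^ 2)
  have b0 := hle (-γ ^ 3) (γ ^ 2)
  have b1 := hle (-γ ^ 3) (γ ^ 2 * ω)
  have b2 := hle (-γ ^ 3) (γ ^ 2 * ω ^ 2)
  generalize Module.finrank ℂ ((A * B * A).eigenspace (γ ^ 3)) = n₀ at *
  generalize Module.finrank ℂ ((A * B * A).eigenspace (-γ ^ 3)) = n₁ at *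
  generalize Module.finrank ℂ ((A * B).eigenspace (γ ^ 2)) = m₀ at *
  generalize Module.finrank ℂ ((A * B).eigenspace (γ ^ 2 * ω)) = m₁ at *
  generalize Module.finrank ℂ ((A * B).eigenspace (γ ^ 2 * ω ^ 2)) = m₂ at *
  rw [h.det_half_twist, hΔ, hd, show (γ ^ 3) ^ 5 = Δ ^ 3 by rw [← hγ5]; ring,
    left_eq_mul₀ (pow_ne_zero _ hΔ0), neg_one_pow_eq_one_iff_even (by norm_num)] at hdS
  rw [h.det_third_twist, hΔ, hd, show (γ ^ 2) ^ 5 = Δ ^ 2 by rw [← hγ5]; ring,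
    left_eq_mul₀ (pow_ne_zero _ hΔ0), pow_eq_one_iff_three_dvd hω] at hdT
  obtain ⟨k, hk⟩ := hdS
  obtain ⟨rfl, rfl⟩ : n₀ = 3 ∧ n₁ = 2 := by omega
  obtain ⟨rfl, rfl, rfl⟩ : m₀ = 1 ∧ m₁ = 2 ∧ m₂ = 2 := by
    have : m₂ = 1 ∨ m₂ = 2 := by omega
    rcases this with rfl | rfl <;> omega
  refine ⟨?_, ?_, ?_⟩
  · rw [hT]; push_cast; linear_combination 2 * γ ^ 2 * hω
  · rw [hS]; push_cast; ring
  · rw [hTT]; push_cast; linear_combination 2 * γ ^ 4 * hω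

open ComplexConjugate in
/-- The traces of `A B A`, `A B` and `(A B)²` when the scalar `c` has modulus one. -/
theorem conj_traces (h : IsBraidPair A B c) (hc : ‖c‖ = 1) :
    LinearMap.trace ℂ V (A * B * A) = c * conj (LinearMap.trace ℂ V (A * B * A)) ∧
    LinearMap.trace ℂ V (A * B * (A * B)) = c * conj (LinearMap.trace ℂ V (A * B)) := by
  obtain ⟨ε, hε⟩ := IsAlgClosed.exists_pow_nat_eq c (n := 2) (by norm_num)
  obtain ⟨τ, hτ⟩ := IsAlgClosed.exists_pow_nat_eq c (n := 3) (by norm_num)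
  obtain ⟨ω, hω⟩ := exists_sq_add_self_add_one_eq_zero
  have h3 := cube_eq_one_of_sq_add hω
  have norm_of_pow : ∀ (z : ℂ) (n : ℕ), n ≠ 0 → ‖z ^ n‖ = 1 → z * conj z = 1 := by
    intro z n hn hz
    rw [norm_pow] at hz
    have := (pow_eq_one_iff_of_nonneg (norm_nonneg z) hn).mp hz
    rw [Complex.mul_conj, Complex.normSq_eq_norm_sq, this]; simp
  -- All eigenvalues are unimodular, so conjugating a trace gives the trace of the inverse, and S⁻¹
  -- = S/c, T⁻¹ = T²/c.
  have hε1 := norm_of_pow ε 2 (by norm_num) (by rw [hε, hc])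
  have hτ1 := norm_of_pow τ 3 (by norm_num) (by rw [hτ, hc])
  have hω1 := norm_of_pow ω 3 (by norm_num) (by rw [h3]; simp)
  obtain ⟨-, hS, -⟩ := h.half_twist_spectrum hε rfl rfl
  obtain ⟨-, hT, hTT, -⟩ := h.third_twist_spectrum hτ hω rfl rfl rfl
  have hωc : conj ω = ω ^ 2 := by linear_combination ω ^ 2 * hω1 - conj ω * h3
  constructor
  · rw [hS]
    simp only [map_mul, map_sub, Complex.conj_natCast]
    rw [← hε]
    linear_combination (-((Module.finrank ℂ ((A * B * A).eigenspace ε) : ℂ) -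
      (Module.finrank ℂ ((A * B * A).eigenspace (-ε)) : ℂ)) * ε) * hε1
  · rw [hT, hTT]
    simp only [map_mul, map_add, map_pow, Complex.conj_natCast, hωc]
    rw [← hτ, ← pow_mul, show ω ^ (2 * 2) = ω by linear_combination ω * h3]
    generalize (Module.finrank ℂ ((A * B).eigenspace τ) : ℂ) = x
    generalize (Module.finrank ℂ ((A * B).eigenspace (τ * ω)) : ℂ) = y
    generalize (Module.finrank ℂ ((A * B).eigenspace (τ * ω ^ 2)) : ℂ) = z
    linear_combination (-τ ^ 2 * (x + y * ω ^ 2 + z * ω)) * hτ1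

end IsBraidPair

/-! ### Elimination identities behind the closed formulas -/

section ScalarIdentities

/-- The identity left at the end of the elimination for d = 5: p, q, t are the elementary symmetric
functions of the other three eigenvalues, N is the numerator of a diagonal entry, and the two long
factors on the right are ∏(g² + a k) and ∏(g² + b k), expanded. -/
theorem diag_sq_identity_five {a b p q t g : ℂ} (ha : a ≠ 0) (hb : b ≠ 0)
    (h : a * b * t = g ^ 5) (N : ℂ)
    (hN : N = g * (a * (b * q + t) + b * t) + g ^ 4 * (b + p) + g ^ 3 * (b * p + q) +
      g ^ 2 * (b * q + t) + b * t * (a + (b + p))) :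
    -b * g ^ 8 * ((a - b) ^ 2 * (a ^ 3 - p * a ^ 2 + q * a - t) * ((a * q - g * b * p) * g ^ 6) +
      ((g * b * q - a * t) * a ^ 4 + (g * b - a * p) * g ^ 6) * (a - b) * N -
      N ^ 2 * (a ^ 2 + g * b) * a ^ 2) =
    g ^ 6 * (a + g) * ((g ^ 2 + a * g + a ^ 2) * (g ^ 2 + b * g + b ^ 2) *
      ((g ^ 6 + g ^ 4 * a * p + g ^ 2 * a ^ 2 * q + a ^ 3 * t) *
        (g ^ 6 + g ^ 4 * b * p + g ^ 2 * b ^ 2 * q + b ^ 3 * t))) := by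
  obtain rfl : t = g ^ 5 / (a * b) := by field_simp; linear_combination h
  rw [hN]
  field_simp
  ring


/-- Here β_x are the diagonal entries and y_x the products b_ax b_xa, with indices named by their
eigenvalues. The t_m are the traces of A^m B, the e_m the moments of row a against column a. -/
theorem offDiag_formula_five_aux {a b k l n g : ℂ} (ha : a ≠ 0) (hb : b ≠ 0) (hag : a + g ≠ 0)
    (hg : g ^ 5 = a * b * (k * l * n)) {βa βb βk βl βn yb yk yl yn : ℂ}
    (t₀ : βa + (βb + (βk + (βl + βn))) = a + (b + (k + (l + n))))
    (t₁ : a * βa + (b * βb + (k * βk + (l * βl + n * βn))) = -g ^ 2)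
    (t₂ : a ^ 2 * βa + (b ^ 2 * βb + (k ^ 2 * βk + (l ^ 2 * βl + n ^ 2 * βn))) = g ^ 3)
    (t₃ : a ^ 3 * βa + (b ^ 3 * βb + (k ^ 3 * βk + (l ^ 3 * βl + n ^ 3 * βn))) = -g ^ 4)
    (t₄ : a ^ 4 * βa + (b ^ 4 * βb + (k ^ 4 * βk + (l ^ 4 * βl + n ^ 4 * βn))) =
      g * (b * k * l * n + a * k * l * n + a * b * l * n + a * b * k * n + a * b * k * l))
    (e₁ : a * βa ^ 2 + (b * yb + (k * yk + (l * yl + n * yn))) = a ^ 2 * βa)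
    (e₂ : a ^ 2 * (a ^ 2 * βa ^ 2 + (b ^ 2 * yb + (k ^ 2 * yk + (l ^ 2 * yl + n ^ 2 * yn)))) =
      g ^ 6)
    (e₃ : a ^ 2 * (a ^ 3 * βa ^ 2 + (b ^ 3 * yb + (k ^ 3 * yk + (l ^ 3 * yl + n ^ 3 * yn)))) =
      g ^ 6 * βa)
    (e₄ : a ^ 2 * (a ^ 4 * βa ^ 2 + (b ^ 4 * yb + (k ^ 4 * yk + (l ^ 4 * yl + n ^ 4 * yn)))) =
      g ^ 6 * (βa ^ 2 + (yb + (yk + (yl + yn))))) :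
    a ^ 2 * b ^ 2 * yb * g ^ 8 * (((a - b) * ((a - k) * ((a - l) * (a - n)))) *
      ((b - a) * ((b - k) * ((b - l) * (b - n))))) =
    g ^ 6 * ((g ^ 2 + a * g + a ^ 2) * (g ^ 2 + b * g + b ^ 2) *
      ((g ^ 2 + a * k) * (g ^ 2 + b * k) * ((g ^ 2 + a * l) * (g ^ 2 + b * l) *
        ((g ^ 2 + a * n) * (g ^ 2 + b * n))))) := by
  obtain ⟨p, hp⟩ : ∃ p, p = k + l + n := ⟨_, rfl⟩
  obtain ⟨q, hq⟩ : ∃ q, q = k * l + k * n + l * n := ⟨_, rfl⟩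
  obtain ⟨t, ht⟩ : ∃ t, t = k * l * n := ⟨_, rfl⟩
  have hg' : a * b * t = g ^ 5 := by rw [hg, ht]
  obtain ⟨N, hN⟩ : ∃ N, N = g * (a * (b * q + t) + b * t) + g ^ 4 * (b + p) +
    g ^ 3 * (b * p + q) + g ^ 2 * (b * q + t) + b * t * (a + (b + p)) := ⟨_, rfl⟩
  -- Pairing the trace moments with (x − b)(x − k)(x − l)(x − n) isolates βa.
  have h1 : βa * ((a - b) * (a ^ 3 - p * a ^ 2 + q * a - t)) = N := by
    rw [hN, hp, hq, ht]
    linear_combination t₄ - (b + (k + l + n)) * t₃ +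
      (b * (k + l + n) + (k * l + k * n + l * n)) * t₂ -
      (b * (k * l + k * n + l * n) + k * l * n) * t₁ + b * (k * l * n) * t₀
  -- The weight is (a x + g b)(x − k)(x − l)(x − n). The factor a x + g b is chosen so that, by
  -- `hg`, the constant term matches the order-zero sum on the right of `e₄`. Its value at x = b is
  -- b(a + g), whence the hypothesis `hag`.
  have h2 : yb * (b ^ 3 - p * b ^ 2 + q * b - t) * b * (a + g) * a ^ 2 +
      βa ^ 2 * (a ^ 3 - p * a ^ 2 + q * a - t) * (a ^ 2 + g * b) * a ^ 2 =
      (g * b * q - a * t) * a ^ 4 * βa + (a * q - g * b * p) * g ^ 6 +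
        (g * b - a * p) * g ^ 6 * βa := by
    rw [hp, hq, ht]
    linear_combination (g * b * (k * l + k * n + l * n) - a * (k * l * n)) * a ^ 2 * e₁ +
      (a * (k * l + k * n + l * n) - g * b * (k + l + n)) * e₂ + (g * b - a * (k + l + n)) * e₃ +
      a * e₄ + a * g * (βa ^ 2 + (yb + (yk + (yl + yn)))) * hg
  have h3 := diag_sq_identity_five ha hb hg' N hN
  have h4 : (a + g) * (a ^ 2 * b ^ 2 * yb * g ^ 8 *
      ((a - b) * (a ^ 3 - p * a ^ 2 + q * a - t) *
        ((b - a) * (b ^ 3 - p * b ^ 2 + q * b - t)))) =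
      (a + g) * (g ^ 6 * ((g ^ 2 + a * g + a ^ 2) * (g ^ 2 + b * g + b ^ 2) *
      ((g ^ 6 + g ^ 4 * a * p + g ^ 2 * a ^ 2 * q + a ^ 3 * t) *
        (g ^ 6 + g ^ 4 * b * p + g ^ 2 * b ^ 2 * q + b ^ 3 * t)))) := by
    rw [← h1] at h3
    linear_combination h3 - b * g ^ 8 * (a - b) ^ 2 * (a ^ 3 - p * a ^ 2 + q * a - t) * h2
  have h5 := mul_left_cancel₀ hag h4
  rw [hp, hq, ht] at h5
  linear_combination h5

theorem offDiag_formula_four_aux {a b k l g : ℂ} (ha : a ≠ 0) (hb : b ≠ 0)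
    (hg : g ^ 2 = a * b * (k * l)) {βa βb βk βl yb yk yl : ℂ}
    (t₀ : βa + (βb + (βk + βl)) = a + (b + (k + l)))
    (t₁ : a * βa + (b * βb + (k * βk + l * βl)) = -g)
    (t₂ : a ^ 2 * βa + (b ^ 2 * βb + (k ^ 2 * βk + l ^ 2 * βl)) = 0)
    (t₃ : a ^ 3 * βa + (b ^ 3 * βb + (k ^ 3 * βk + l ^ 3 * βl)) = g ^ 2)
    (e₁ : a * βa ^ 2 + (b * yb + (k * yk + l * yl)) = a ^ 2 * βa)
    (e₂ : a ^ 2 * (a ^ 2 * βa ^ 2 + (b ^ 2 * yb + (k ^ 2 * yk + l ^ 2 * yl))) = -g ^ 3)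
    (e₃ : a ^ 2 * (a ^ 3 * βa ^ 2 + (b ^ 3 * yb + (k ^ 3 * yk + l ^ 3 * yl))) = -g ^ 3 * βa) :
    a ^ 2 * b ^ 2 * yb * g * (((a - b) * ((a - k) * (a - l))) *
      ((b - a) * ((b - k) * (b - l)))) =
    g ^ 3 * ((a ^ 2 + g) * (b ^ 2 + g) * ((g + a * k + b * l) * (g + a * l + b * k))) := by
  obtain ⟨p, hp⟩ : ∃ p, p = k + l := ⟨_, rfl⟩
  obtain ⟨q, hq⟩ : ∃ q, q = k * l := ⟨_, rfl⟩
  obtain ⟨N, hN⟩ : ∃ N, N = g ^ 2 - g * (b * p + q) - b * q * (a + b + p) := ⟨_, rfl⟩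
  have h1 : βa * ((a - b) * (a ^ 2 - p * a + q)) = N := by
    rw [hN, hp, hq]
    linear_combination t₃ - (b + (k + l)) * t₂ + (b * (k + l) + k * l) * t₁ - b * (k * l) * t₀
  -- The weight x(x − k)(x − l) uses orders one to three only, so the fourth moment is not needed.
  have h2 : yb * (b ^ 2 - p * b + q) * b * a ^ 2 + βa ^ 2 * (a ^ 2 - p * a + q) * a ^ 3 =
      q * a ^ 4 * βa + p * g ^ 3 - g ^ 3 * βa := by
    rw [hp, hq]
    linear_combination k * l * a ^ 2 * e₁ - (k + l) * e₂ + e₃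
  have h3 : -b * g * ((a - b) ^ 2 * (a ^ 2 - p * a + q) * (p * g ^ 3) +
      (q * a ^ 4 - g ^ 3) * (a - b) * N - a ^ 3 * N ^ 2) =
      g ^ 3 * ((a ^ 2 + g) * (b ^ 2 + g) *
        (g ^ 2 + g * (a + b) * p + (a ^ 2 + b ^ 2) * q + a * b * (p ^ 2 - 2 * q))) := by
    obtain rfl : q = g ^ 2 / (a * b) := by field_simp; rw [hq]; linear_combination -hg
    rw [hN]
    field_simp
    ring
  rw [← h1] at h3
  have h4 : a ^ 2 * b ^ 2 * yb * g *
      ((a - b) * (a ^ 2 - p * a + q) * ((b - a) * (b ^ 2 - p * b + q))) =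
      g ^ 3 * ((a ^ 2 + g) * (b ^ 2 + g) *
        (g ^ 2 + g * (a + b) * p + (a ^ 2 + b ^ 2) * q + a * b * (p ^ 2 - 2 * q))) := by
    linear_combination h3 - b * g * (a - b) ^ 2 * (a ^ 2 - p * a + q) * h2
  rw [hp, hq] at h4
  linear_combination h4

theorem offDiag_formula_three_aux {a b k βa βb βk yb yk : ℂ}
    (t₀ : βa + (βb + βk) = a + (b + k))
    (t₁ : a * βa + (b * βb + k * βk) = 0)
    (t₂ : a ^ 2 * βa + (b ^ 2 * βb + k ^ 2 * βk) = -(a * b * k))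
    (e₂ : a ^ 2 * (a ^ 2 * βa ^ 2 + (b ^ 2 * yb + k ^ 2 * yk)) = (a * b * k) ^ 2)
    (e₃ : a ^ 2 * (a ^ 3 * βa ^ 2 + (b ^ 3 * yb + k ^ 3 * yk)) = (a * b * k) ^ 2 * βa) :
    a ^ 2 * b ^ 2 * yb * (((a - b) * (a - k)) * ((b - a) * (b - k))) =
    (a * b * k) ^ 2 * ((a ^ 2 + b * k) * (b ^ 2 + a * k)) := by
  have h1 : βa * ((a - b) * (a - k)) = b * k * (b + k) := by
    linear_combination t₂ - (b + k) * t₁ + b * k * t₀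
  -- The weight is x²(x − k).
  have h2 : yb * b ^ 2 * (b - k) * a ^ 2 + βa ^ 2 * a ^ 2 * (a - k) * a ^ 2 =
      (a * b * k) ^ 2 * (βa - k) := by
    linear_combination e₃ - k * e₂
  have h3 : -((a - b) ^ 2 * (a - k) * ((a * b * k) ^ 2 * (-k)) +
      (a - b) * (b * k * (b + k)) * (a * b * k) ^ 2 - a ^ 4 * (b * k * (b + k)) ^ 2) =
      (a * b * k) ^ 2 * ((a ^ 2 + b * k) * (b ^ 2 + a * k)) := by ring
  rw [← h1] at h3
  linear_combination h3 - (a - b) ^ 2 * (a - k) * h2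

theorem offDiag_formula_two_aux {a b βa βb yb : ℂ}
    (t₀ : βa + βb = a + b) (t₁ : a * βa + b * βb = a * b)
    (e₂ : a ^ 2 * (a ^ 2 * βa ^ 2 + b ^ 2 * yb) = -(a * b) ^ 3) :
    a ^ 2 * b ^ 2 * yb * ((a - b) * (b - a)) =
    -(a * b) ^ 3 * (-a ^ 2 + a * b - b ^ 2) := by
  have h1 : βa * (a - b) = -b ^ 2 := by linear_combination t₁ - b * t₀
  have h3 : (a - b) ^ 2 * (a * b) ^ 3 + a ^ 4 * (-b ^ 2) ^ 2 =
      -(a * b) ^ 3 * (-a ^ 2 + a * b - b ^ 2) := by ring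
  rw [← h1] at h3
  linear_combination h3 - (a - b) ^ 2 * e₂

end ScalarIdentities

/-! ### Moment equations for the matrix of the second generator -/

open ComplexConjugate

/-- A linear combination of powers that vanishes for as many exponents as there are nodes has
vanishing coefficients. -/
theorem eq_zero_of_sum_mul_pow_eq_zero {ι : Type*} (s : Finset ι) (x w : ι → ℂ)
    (hx : Set.InjOn x s) {N : ℕ} (hN : s.card ≤ N)
    (h : ∀ m < N, ∑ j ∈ s, w j * x j ^ m = 0) : ∀ j ∈ s, w j = 0 := by
  classical
  intro j hj
  have hdeg : (Lagrange.basis s x j).natDegree < N := by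
    have h1 := Lagrange.degree_basis hx hj
    have h2 : 0 < s.card := Finset.card_pos.mpr ⟨j, hj⟩
    rw [Polynomial.natDegree_eq_of_degree_eq_some h1]
    omega
  have h1 : ∑ i ∈ s, w i * (Lagrange.basis s x j).eval (x i) = 0 := by
    simp_rw [Polynomial.eval_eq_sum_range' hdeg, Finset.mul_sum]
    rw [Finset.sum_comm]
    refine Finset.sum_eq_zero fun m hm => ?_
    have h2 := h m (Finset.mem_range.mp hm)
    calc _ = (Lagrange.basis s x j).coeff m * ∑ i ∈ s, w i * x i ^ m := by
          rw [Finset.mul_sum]; exact Finset.sum_congr rfl fun i _ => by ring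
      _ = 0 := by rw [h2, mul_zero]
  rw [Finset.sum_eq_single_of_mem j hj, Lagrange.eval_basis_self hx hj, mul_one] at h1
  · exact h1
  · intro i hi hij
    rw [Lagrange.eval_basis_of_ne (Ne.symm hij) hi, mul_zero]

/-- `b` is the matrix of the second generator in an eigenbasis of the first, with eigenvalues
`lam`, and `c` is the scalar by which the full twist acts. -/
structure IsBraidMatrix {d : ℕ} (lam : Fin d → ℂ) (c : ℂ) (b : Matrix (Fin d) (Fin d) ℂ) :
    Prop where
  lam_ne_zero : ∀ i, lam i ≠ 0
  ne_zero : c ≠ 0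
  braid : Matrix.diagonal lam * b * Matrix.diagonal lam = b * Matrix.diagonal lam * b
  sq : (Matrix.diagonal lam * b * Matrix.diagonal lam) *
    (Matrix.diagonal lam * b * Matrix.diagonal lam) = c • 1

namespace IsBraidMatrix

variable {d : ℕ} {lam : Fin d → ℂ} {c : ℂ} {b : Matrix (Fin d) (Fin d) ℂ}

theorem semiconj (h : IsBraidMatrix lam c b) :
    Matrix.diagonal lam * b * Matrix.diagonal lam * Matrix.diagonal lam =
      b * (Matrix.diagonal lam * b * Matrix.diagonal lam) := by
  nth_rewrite 1 [h.braid]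
  noncomm_ring

theorem conj_eq_smul (h : IsBraidMatrix lam c b) :
    Matrix.diagonal lam * b * Matrix.diagonal lam * Matrix.diagonal lam *
      (Matrix.diagonal lam * b * Matrix.diagonal lam) = c • b := by
  rw [h.semiconj, mul_assoc, h.sq, mul_smul_comm, mul_one]

theorem conj_sq_eq_smul (h : IsBraidMatrix lam c b) :
    Matrix.diagonal lam * b * Matrix.diagonal lam * Matrix.diagonal lam * Matrix.diagonal lam *
      (Matrix.diagonal lam * b * Matrix.diagonal lam) = c • (b * b) := by
  rw [h.semiconj, mul_assoc b, mul_assoc b, h.conj_eq_smul, mul_smul_comm]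

/-- This and the next three moments are the entries of ABA = BAB, S² = c, SAS = cB and SA²S = cB².
-/
theorem sum_pow_one (h : IsBraidMatrix lam c b) (i k : Fin d) :
    ∑ j, lam j * (b i j * b j k) = lam i * lam k * b i k := by
  have h1 := congrFun (congrFun h.braid i) k
  rw [Matrix.mul_diagonal, Matrix.diagonal_mul, Matrix.mul_apply] at h1
  simp only [Matrix.mul_diagonal] at h1
  rw [mul_right_comm, h1]
  exact Finset.sum_congr rfl fun j _ => by ring

theorem sum_pow_two (h : IsBraidMatrix lam c b) (i k : Fin d) :
    lam i * lam k * ∑ j, lam j ^ 2 * (b i j * b j k) = if i = k then c else 0 := by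
  have h1 := congrFun (congrFun h.sq i) k
  rw [Matrix.mul_apply] at h1
  simp only [Matrix.mul_diagonal, Matrix.diagonal_mul] at h1
  rw [Matrix.smul_apply, Matrix.one_apply, smul_eq_mul, mul_ite, mul_one, mul_zero] at h1
  rw [← h1, Finset.mul_sum]
  exact Finset.sum_congr rfl fun j _ => by ring

theorem sum_pow_three (h : IsBraidMatrix lam c b) (i k : Fin d) :
    lam i * lam k * ∑ j, lam j ^ 3 * (b i j * b j k) = c * b i k := by
  have h1 := congrFun (congrFun h.conj_eq_smul i) k
  rw [Matrix.mul_apply] at h1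
  simp only [Matrix.mul_diagonal, Matrix.diagonal_mul] at h1
  rw [Matrix.smul_apply, smul_eq_mul] at h1
  rw [← h1, Finset.mul_sum]
  exact Finset.sum_congr rfl fun j _ => by ring

theorem sum_pow_four (h : IsBraidMatrix lam c b) (i k : Fin d) :
    lam i * lam k * ∑ j, lam j ^ 4 * (b i j * b j k) = c * ∑ j, b i j * b j k := by
  have h1 := congrFun (congrFun h.conj_sq_eq_smul i) k
  rw [Matrix.mul_apply] at h1
  simp only [Matrix.mul_diagonal, Matrix.diagonal_mul] at h1
  rw [Matrix.smul_apply, smul_eq_mul, Matrix.mul_apply] at h1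
  rw [← h1, Finset.mul_sum]
  exact Finset.sum_congr rfl fun j _ => by ring

theorem sum_diag (h : IsBraidMatrix lam c b) : ∑ i, b i i = ∑ i, lam i := by
  apply mul_left_cancel₀ h.ne_zero
  rw [Finset.mul_sum, Finset.mul_sum]
  simp_rw [← h.sum_pow_three, Finset.mul_sum]
  rw [Finset.sum_comm]
  refine Finset.sum_congr rfl fun j _ => ?_
  have h1 := h.sum_pow_two j j
  rw [if_pos rfl] at h1
  rw [← h1, Finset.mul_sum, Finset.sum_mul]
  exact Finset.sum_congr rfl fun i _ => by ring

/-- By cyclicity tr(A⁴B) = tr(A²·BAB) = tr(ABA²B), and ABA²B = S²A⁻¹ = cA⁻¹. -/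
theorem sum_pow_four_diag (h : IsBraidMatrix lam c b) :
    ∑ i, lam i ^ 4 * b i i = c * ∑ i, (lam i)⁻¹ := by
  have h1 : ∀ i, lam i ^ 4 * b i i = ∑ j, lam j * lam i ^ 2 * (b i j * b j i) := by
    intro i
    calc lam i ^ 4 * b i i = lam i ^ 2 * (lam i * lam i * b i i) := by ring
      _ = _ := by
        rw [← h.sum_pow_one, Finset.mul_sum]
        exact Finset.sum_congr rfl fun j _ => by ring
  simp_rw [h1]
  rw [Finset.sum_comm, Finset.mul_sum]
  refine Finset.sum_congr rfl fun j _ => ?_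
  have h2 := h.sum_pow_two j j
  rw [if_pos rfl] at h2
  rw [← h2, Finset.mul_sum, Finset.sum_mul]
  refine Finset.sum_congr rfl fun i _ => ?_
  have := h.lam_ne_zero j
  field_simp

/-- A weight supported off two indices is determined by three consecutive moments. -/
theorem eq_zero_of_moments (h : IsBraidMatrix lam c b) (hd : d ≤ 5)
    (hinj : Function.Injective lam) {i k : Fin d} (hik : i ≠ k) {w : Fin d → ℂ} (hi : w i = 0)
    (hk : w k = 0) (h₁ : ∑ j, lam j * w j = 0) (h₂ : ∑ j, lam j ^ 2 * w j = 0)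
    (h₃ : ∑ j, lam j ^ 3 * w j = 0) (j : Fin d) : w j = 0 := by
  by_cases hj : j ∈ (Finset.univ.erase i).erase k
  · have hcard : ((Finset.univ.erase i).erase k).card ≤ 3 := by
      rw [Finset.card_erase_of_mem (by simp [hik.symm]), Finset.card_erase_of_mem (by simp),
        Finset.card_univ, Fintype.card_fin]
      omega
    have h0 : ∀ m < 3, ∑ j ∈ (Finset.univ.erase i).erase k, lam j * w j * lam j ^ m = 0 := by
      intro m hm
      rw [Finset.sum_erase _ (by simp [hk]), Finset.sum_erase _ (by simp [hi])]
      interval_cases m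
      · simpa using h₁
      · rw [← h₂]; exact Finset.sum_congr rfl fun j _ => by ring
      · rw [← h₃]; exact Finset.sum_congr rfl fun j _ => by ring
    have h1 := eq_zero_of_sum_mul_pow_eq_zero _ lam _ hinj.injOn hcard h0 j hj
    exact (mul_eq_zero.mp h1).resolve_left (h.lam_ne_zero j)
  · simp only [Finset.mem_erase, Finset.mem_univ, and_true, not_and_or, not_not] at hj
    rcases hj with rfl | rfl
    · exact hk
    · exact hi

/-- The products vanish at j = i and j = k, and their moments of orders one to three are zero; since
d ≤ 5, at most three indices remain. -/
theorem mul_eq_zero_of_eq_zero (h : IsBraidMatrix lam c b) (hd : d ≤ 5)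
    (hinj : Function.Injective lam) {i k : Fin d} (hik : i ≠ k) (h0 : b i k = 0) (j : Fin d) :
    b i j * b j k = 0 := by
  have hl := mul_ne_zero (h.lam_ne_zero i) (h.lam_ne_zero k)
  apply h.eq_zero_of_moments hd hinj hik (w := fun j => b i j * b j k)
  · simp [h0]
  · simp [h0]
  · rw [h.sum_pow_one, h0, mul_zero]
  · simpa [hik, h.lam_ne_zero] using h.sum_pow_two i k
  · simpa [h0, h.lam_ne_zero] using h.sum_pow_three i k

/-- If no proper coordinate subspace is invariant, then no off-diagonal entry vanishes. -/
theorem entry_ne_zero (h : IsBraidMatrix lam c b) (hd : d ≤ 5) (hinj : Function.Injective lam)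
    (hirr : ∀ J : Set (Fin d), J.Nonempty → (∀ k ∈ J, ∀ j ∉ J, b j k = 0) → J = Set.univ)
    {i k : Fin d} (hik : i ≠ k) : b i k ≠ 0 := by
  intro h0
  -- The vanishing of all two-step products into a zero entry makes the support of column k,
  -- together with k, already closed.
  have hJ := hirr {j | j = k ∨ b j k ≠ 0} ⟨k, Or.inl rfl⟩ (by
    intro l hl j hj
    simp only [Set.mem_ofPred_eq, not_or, not_not] at hl hj
    rcases hl with rfl | hl
    · exact hj.2
    · exact (mul_eq_zero.mp (h.mul_eq_zero_of_eq_zero hd hinj hj.1 hj.2 l)).resolve_right hl)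
  have h1 : i ∈ ({j | j = k ∨ b j k ≠ 0} : Set (Fin d)) := hJ ▸ Set.mem_univ i
  rcases h1 with h1 | h1
  · exact hik h1
  · exact h1 h0

/-- The triple products of matrix entries do not depend on the orientation. -/
theorem triple_symm (h : IsBraidMatrix lam c b) (hd : d ≤ 5) (hinj : Function.Injective lam)
    {i k : Fin d} (hik : i ≠ k) (j : Fin d) :
    b i j * b j k * b k i = b k j * b j i * b i k := by
  have hl := mul_ne_zero (h.lam_ne_zero i) (h.lam_ne_zero k)
  have expand : ∀ m, ∑ j, lam j ^ m * (b i j * b j k * b k i - b k j * b j i * b i k) =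
      b k i * (∑ j, lam j ^ m * (b i j * b j k)) - b i k * ∑ j, lam j ^ m * (b k j * b j i) := by
    intro m
    rw [Finset.mul_sum, Finset.mul_sum, ← Finset.sum_sub_distrib]
    exact Finset.sum_congr rfl fun j _ => by ring
  rw [← sub_eq_zero]
  -- The two orientations have equal moments of orders one to three, because each moment for (i, k)
  -- is zero or proportional to b_ik, with a factor symmetric in i and k.
  apply h.eq_zero_of_moments hd hinj hik
    (w := fun j => b i j * b j k * b k i - b k j * b j i * b i k)
  · ring
  · ring
  · have h1 := expand 1
    simp only [pow_one] at h1
    rw [h1, h.sum_pow_one, h.sum_pow_one]; ring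
  · apply mul_left_cancel₀ hl
    have e1 := h.sum_pow_two i k
    have e2 := h.sum_pow_two k i
    rw [if_neg hik] at e1
    rw [if_neg hik.symm] at e2
    rw [expand]
    linear_combination b k i * e1 - b i k * e2
  · apply mul_left_cancel₀ hl
    rw [expand]
    linear_combination b k i * h.sum_pow_three i k - b i k * h.sum_pow_three k i


end IsBraidMatrix

/-! ### Reality of the entries and construction of the weights -/

namespace IsBraidMatrix

variable {d : ℕ} {lam : Fin d → ℂ} {c : ℂ} {b : Matrix (Fin d) (Fin d) ℂ}

/-- The traces t_m of A^m B satisfy t_m = c · conj t_{4−m} for m = 0, …, 4. Hence b_ii and c ·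
conj(b_ii) · conj(λ_i)⁴ have the same five moments, and there are at most five nodes. -/
theorem diag_real (h : IsBraidMatrix lam c b) (hd : d ≤ 5) (hinj : Function.Injective lam)
    (hlam : ∀ i, lam i * conj (lam i) = 1) (hc : c * conj c = 1)
    (h₂ : ∑ i, lam i ^ 2 * b i i = c * conj (∑ i, lam i ^ 2 * b i i))
    (h₃ : ∑ i, lam i ^ 3 * b i i = c * conj (∑ i, lam i * b i i)) (i : Fin d) :
    lam i ^ 4 * b i i = c * conj (b i i) := by
  have hinv : ∀ i, (lam i)⁻¹ = conj (lam i) := fun i => inv_eq_of_mul_eq_one_right (hlam i)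
  have h₄ : ∑ i, lam i ^ 4 * b i i = c * conj (∑ i, b i i) := by
    rw [h.sum_pow_four_diag, h.sum_diag, map_sum]
    simp_rw [hinv]
  have h₀ : ∑ i, b i i = c * conj (∑ i, lam i ^ 4 * b i i) := by
    rw [h₄, map_mul, Complex.conj_conj, ← mul_assoc, hc, one_mul]
  have h₁ : ∑ i, lam i * b i i = c * conj (∑ i, lam i ^ 3 * b i i) := by
    rw [h₃, map_mul, Complex.conj_conj, ← mul_assoc, hc, one_mul]
  have key : ∀ m n : ℕ, m + n = 4 → ∑ i, lam i ^ m * b i i = c * conj (∑ i, lam i ^ n * b i i) →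
      ∑ j, (b j j - c * conj (b j j) * conj (lam j) ^ 4) * lam j ^ m = 0 := by
    intro m n hmn hs
    calc _ = ∑ j, lam j ^ m * b j j - c * conj (∑ j, lam j ^ n * b j j) := by
          rw [map_sum, Finset.mul_sum, ← Finset.sum_sub_distrib]
          refine Finset.sum_congr rfl fun j _ => ?_
          have e : lam j ^ m * conj (lam j) ^ 4 = conj (lam j) ^ n := by
            rw [← hmn, pow_add, ← mul_assoc, ← mul_pow, hlam, one_pow, one_mul]
          rw [map_mul, map_pow, ← e]
          ring
      _ = 0 := by rw [hs, sub_self]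
  have h5 := eq_zero_of_sum_mul_pow_eq_zero Finset.univ lam
    (fun j => b j j - c * conj (b j j) * conj (lam j) ^ 4) hinj.injOn
    (by simpa using hd) (fun m hm => by
      interval_cases m
      · exact key 0 4 rfl (by simpa using h₀)
      · exact key 1 3 rfl (by simpa using h₁)
      · exact key 2 2 rfl h₂
      · exact key 3 1 rfl (by simpa using h₃)
      · exact key 4 0 rfl (by simpa using h₄)) i (Finset.mem_univ i)
  have e : lam i ^ 4 * conj (lam i) ^ 4 = 1 := by rw [← mul_pow, hlam, one_pow]
  linear_combination lam i ^ 4 * h5 + c * conj (b i i) * e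

/-- The triple products of matrix entries are real up to normalization. -/
theorem triple_real (h : IsBraidMatrix lam c b) (hd : d ≤ 5) (hinj : Function.Injective lam)
    (hlam : ∀ i, lam i * conj (lam i) = 1) (hc : c * conj c = 1)
    (hdiag : ∀ i, lam i ^ 4 * b i i = c * conj (b i i)) {i k : Fin d} (hik : i ≠ k)
    (hpair : lam i ^ 4 * lam k ^ 4 * (b i k * b k i) = c ^ 2 * conj (b i k * b k i))
    (j : Fin d) :
    lam i ^ 4 * lam j ^ 4 * lam k ^ 4 * (b i j * b j k * b k i) =
      c ^ 3 * conj (b i j * b j k * b k i) := by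
  have hl := mul_ne_zero (h.lam_ne_zero i) (h.lam_ne_zero k)
  have e4 : ∀ j, lam j ^ 4 * conj (lam j) ^ 4 = 1 := fun j => by rw [← mul_pow, hlam, one_pow]
  obtain ⟨L, hL⟩ : ∃ L, L = lam i * lam k := ⟨_, rfl⟩
  have hLL : L * conj L = 1 := by
    rw [hL, map_mul]; linear_combination lam i * conj (lam i) * hlam k + hlam i
  obtain ⟨p, hp⟩ : ∃ p, p = b i k * b k i := ⟨_, rfl⟩
  have hpair' : L ^ 4 * p = c ^ 2 * conj p := by rw [hL, mul_pow, hp]; exact hpair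
  have hL4 : L ^ 4 * conj L ^ 4 = 1 := by rw [← mul_pow, hLL, one_pow]
  have expand : ∀ m n : ℕ, m + n = 4 →
      ∑ j, lam j ^ m * (b i j * b j k * b k i -
        c ^ 3 * conj L ^ 4 * conj (lam j) ^ 4 * conj (b i j * b j k * b k i)) =
      b k i * (∑ j, lam j ^ m * (b i j * b j k)) -
        c ^ 3 * conj L ^ 4 * conj (b k i) * conj (∑ j, lam j ^ n * (b i j * b j k)) := by
    intro m n hmn
    rw [map_sum, Finset.mul_sum, Finset.mul_sum, ← Finset.sum_sub_distrib]
    refine Finset.sum_congr rfl fun j _ => ?_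
    have e : lam j ^ m * conj (lam j) ^ 4 = conj (lam j) ^ n := by
      rw [← hmn, pow_add, ← mul_assoc, ← mul_pow, hlam, one_pow, one_mul]
    rw [map_mul _ (lam j ^ n), map_pow, ← e, map_mul _ _ (b k i)]
    ring
  have s1 := h.sum_pow_one i k
  have s2 := h.sum_pow_two i k
  have s3 := h.sum_pow_three i k
  rw [if_neg hik] at s2
  rw [← hL] at s1 s2 s3 hl
  have s2' := (mul_eq_zero.mp s2).resolve_left hl
  have s3' : ∑ j, lam j ^ 3 * (b i j * b j k) = conj L * c * b i k := by
    linear_combination conj L * s3 - (∑ j, lam j ^ 3 * (b i j * b j k)) * hLL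
  -- At the two indices i and k the claim follows from reality of the diagonal entry and of the pair
  -- product; the moments then handle the at most three others.
  have end_i : lam i ^ 4 * (b i i * p) * L ^ 4 = c ^ 3 * conj (b i i * p) := by
    rw [map_mul]
    linear_combination (L ^ 4 * p) * hdiag i + c * conj (b i i) * hpair'
  have end_k : lam k ^ 4 * (b k k * p) * L ^ 4 = c ^ 3 * conj (b k k * p) := by
    rw [map_mul]
    linear_combination (L ^ 4 * p) * hdiag k + c * conj (b k k) * hpair'
  have w0 := h.eq_zero_of_moments hd hinj hik (w := fun j => b i j * b j k * b k i -
      c ^ 3 * conj L ^ 4 * conj (lam j) ^ 4 * conj (b i j * b j k * b k i)) (by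
      show b i i * b i k * b k i -
        c ^ 3 * conj L ^ 4 * conj (lam i) ^ 4 * conj (b i i * b i k * b k i) = 0
      rw [mul_assoc (b i i), ← hp]
      linear_combination (-(conj L) ^ 4 * conj (lam i) ^ 4) * (-end_i)
        - b i i * p * L ^ 4 * conj L ^ 4 * e4 i - b i i * p * hL4) (by
      show b i k * b k k * b k i -
        c ^ 3 * conj L ^ 4 * conj (lam k) ^ 4 * conj (b i k * b k k * b k i) = 0
      rw [show b i k * b k k * b k i = b k k * p by rw [hp]; ring]
      linear_combination (-(conj L) ^ 4 * conj (lam k) ^ 4) * (-end_k)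
        - b k k * p * L ^ 4 * conj L ^ 4 * e4 k - b k k * p * hL4) (by
      have e := expand 1 3 rfl
      simp only [pow_one] at e
      rw [e, s1, s3', map_mul, map_mul, Complex.conj_conj]
      rw [hp, map_mul] at hpair'
      linear_combination conj L ^ 4 * L * hpair' - L * b i k * b k i * hL4
        - c ^ 2 * conj L ^ 4 * L * conj (b i k) * conj (b k i) * hc) (by
      rw [expand 2 2 rfl, s2', map_zero, mul_zero, mul_zero, sub_zero]) (by
      have e := expand 3 1 rfl
      simp only [pow_one] at e
      rw [e, s1, s3', map_mul]
      rw [hp, map_mul] at hpair'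
      linear_combination c * conj L ^ 5 * hpair' - c * conj L * b i k * b k i * hL4) j
  have eL : lam i ^ 4 * lam k ^ 4 = L ^ 4 := by rw [hL, mul_pow]
  linear_combination (lam i ^ 4 * lam k ^ 4 * lam j ^ 4) * w0 + c ^ 3 *
    conj (b i j * b j k * b k i) * (conj L ^ 4 * lam j ^ 4 * conj (lam j) ^ 4 * eL +
      lam j ^ 4 * conj (lam j) ^ 4 * hL4 + e4 j)

/-- Positive weights for which the half twist is self-adjoint up to normalization. -/
theorem exists_weights [NeZero d] (h : IsBraidMatrix lam c b) (hd : d ≤ 5)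
    (hinj : Function.Injective lam)
    (hlam : ∀ i, lam i * conj (lam i) = 1) (hc : c * conj c = 1)
    (hdiag : ∀ i, lam i ^ 4 * b i i = c * conj (b i i)) (μ : Fin d → Fin d → ℝ)
    (hμ : ∀ i j, lam i ^ 2 * lam j ^ 2 * (b i j * b j i) = c * μ i j)
    (hne : ∀ i j, i ≠ j → b i j ≠ 0) (hpos : ∀ j, j ≠ 0 → 0 < μ 0 j) :
    ∃ w : Fin d → ℝ, (∀ i, 0 < w i) ∧
      ∀ i j, (w i : ℂ) * (lam i * lam j) ^ 2 * b i j = c * conj (b j i) * w j := by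
  have e2 : ∀ j, lam j ^ 2 * conj (lam j) ^ 2 = 1 := fun j => by rw [← mul_pow, hlam, one_pow]
  have hμc : ∀ i j, conj (lam i) ^ 2 * conj (lam j) ^ 2 * (conj (b i j) * conj (b j i)) =
      conj c * μ i j := by
    intro i j
    have := congrArg conj (hμ i j)
    simpa only [map_mul, map_pow, Complex.conj_ofReal] using this
  -- With w_0 = 1, the required relation for the pair (0, j) forces this value.
  let w : Fin d → ℝ := fun j => if j = 0 then 1 else μ 0 j / Complex.normSq (b j 0)
  have w0 : w 0 = 1 := if_pos rfl
  have wj : ∀ j, j ≠ 0 → (w j : ℂ) * (c * conj (b j 0)) = (lam 0 * lam j) ^ 2 * b 0 j := by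
    intro j hj
    have hb := hne j 0 hj
    have hb' : conj (b j 0) ≠ 0 := (map_ne_zero _).mpr hb
    simp only [w, if_neg hj]
    rw [Complex.ofReal_div, Complex.normSq_eq_conj_mul_self]
    field_simp
    linear_combination -hμ 0 j
  refine ⟨w, fun i => ?_, fun i j => ?_⟩
  · by_cases hi : i = 0
    · simp [w, hi]
    · simp only [w, if_neg hi]
      exact div_pos (hpos i hi) (Complex.normSq_pos.mpr (hne i 0 hi))
  · by_cases hij : i = j
    · subst hij
      linear_combination (w i : ℂ) * hdiag i
    by_cases hi : i = 0
    · subst hi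
      rw [w0, Complex.ofReal_one]
      linear_combination -wj j (Ne.symm hij)
    by_cases hj : j = 0
    · subst hj
      rw [w0, Complex.ofReal_one]
      have h1 := congrArg conj (wj i hi)
      simp only [map_mul, map_pow, Complex.conj_ofReal, Complex.conj_conj] at h1
      linear_combination c * (lam i * lam 0) ^ 2 * h1 - w i * (lam i * lam 0) ^ 2 * b i 0 * hc +
        c * conj (b 0 i) * (lam i ^ 2 * conj (lam i) ^ 2 * e2 0 + e2 i)
    -- For i and j both different from 0, the relation is a compatibility around the triangle 0, i,
    -- j, supplied by reality and symmetry of the triple product.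
    have hp : lam 0 ^ 4 * lam j ^ 4 * (b 0 j * b j 0) = c ^ 2 * conj (b 0 j * b j 0) := by
      rw [map_mul]
      linear_combination lam 0 ^ 2 * lam j ^ 2 * hμ 0 j - c ^ 2 * lam 0 ^ 2 * lam j ^ 2 * hμc 0 j
        - c * lam 0 ^ 2 * lam j ^ 2 * μ 0 j * hc + c ^ 2 * conj (b 0 j) * conj (b j 0) *
        (lam 0 ^ 2 * conj (lam 0) ^ 2 * e2 j + e2 0)
    have hX := h.triple_real hd hinj hlam hc hdiag (Ne.symm hj) hp i
    have hX' := h.triple_symm hd hinj (Ne.symm hj) i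
    have hbj := hne j 0 hj
    have hbi' : conj (b i 0) ≠ 0 := (map_ne_zero _).mpr (hne i 0 hi)
    have hbj' : conj (b j 0) ≠ 0 := (map_ne_zero _).mpr hbj
    have hX2 : lam 0 ^ 4 * lam i ^ 4 * lam j ^ 4 * (b 0 i * b i j * b j 0) =
        c ^ 3 * (conj (b j i) * conj (b i 0) * conj (b 0 j)) := by
      rw [hX, hX', map_mul, map_mul]
    have hX3 : lam 0 ^ 2 * lam i ^ 4 * lam j ^ 2 * (b 0 i * b i j * b j 0) * conj (b j 0) =
        c * conj (b j i) * conj (b i 0) * (lam 0 ^ 2 * lam j ^ 2 * (b 0 j * b j 0)) := by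
      linear_combination conj (lam 0) ^ 2 * conj (lam j) ^ 2 * conj (b j 0) * hX2
        - lam 0 ^ 2 * lam i ^ 4 * lam j ^ 2 * (b 0 i * b i j * b j 0) * conj (b j 0) *
          (lam 0 ^ 2 * conj (lam 0) ^ 2 * e2 j + e2 0)
        + c ^ 3 * conj (b j i) * conj (b i 0) * hμc 0 j
        - c * conj (b j i) * conj (b i 0) * hμ 0 j
        + c ^ 2 * μ 0 j * conj (b j i) * conj (b i 0) * hc
    apply mul_left_cancel₀ (mul_ne_zero (mul_ne_zero h.ne_zero hbj) (mul_ne_zero hbi' hbj'))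
    linear_combination (lam i * lam j) ^ 2 * b i j * b j 0 * conj (b j 0) * wj i hi
      - c * conj (b j i) * b j 0 * conj (b i 0) * wj j hj + hX3

end IsBraidMatrix

/-! ### Closed formulas for the products of opposite entries, dimension by dimension -/

section PairComplement

variable {d : ℕ} {i j : Fin d}

theorem sum_univ_eq_add_compl_pair {M : Type*} [AddCommMonoid M] (hij : i ≠ j) (f : Fin d → M) :
    ∑ x, f x = f i + (f j + ∑ x ∈ ({i, j} : Finset (Fin d))ᶜ, f x) := by
  rw [← add_assoc, ← Finset.sum_pair hij, Finset.sum_add_sum_compl]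

theorem prod_univ_eq_mul_compl_pair {M : Type*} [CommMonoid M] (hij : i ≠ j) (f : Fin d → M) :
    ∏ x, f x = f i * (f j * ∏ x ∈ ({i, j} : Finset (Fin d))ᶜ, f x) := by
  rw [← mul_assoc, ← Finset.prod_pair hij, Finset.prod_mul_prod_compl]

theorem prod_erase_eq_mul_compl_pair {M : Type*} [CommMonoid M] (hij : i ≠ j) (f : Fin d → M) :
    ∏ x ∈ Finset.univ.erase i, f x = f j * ∏ x ∈ ({i, j} : Finset (Fin d))ᶜ, f x := by
  rw [← Finset.mul_prod_erase _ f (show j ∈ Finset.univ.erase i by simp [hij.symm])]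
  congr 2
  ext x
  simp [and_comm]

theorem card_compl_pair (hij : i ≠ j) : ({i, j} : Finset (Fin d))ᶜ.card = d - 2 := by
  rw [Finset.card_compl, Finset.card_pair hij, Fintype.card_fin]

end PairComplement

namespace IsBraidMatrix

theorem cleared_formula_two {lam : Fin 2 → ℂ} {c : ℂ} {b : Matrix (Fin 2) (Fin 2) ℂ}
    (h : IsBraidMatrix lam c b) (hc : c = -(∏ i, lam i) ^ 3)
    (t₁ : ∑ i, lam i * b i i = ∏ i, lam i) {i j : Fin 2} (hij : i ≠ j) (γ : ℂ) :
    lam i ^ 2 * lam j ^ 2 * (b i j * b j i) * ((∏ k ∈ Finset.univ.erase i, (lam i - lam k)) *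
      ∏ k ∈ Finset.univ.erase j, (lam j - lam k)) = c * braidQ lam γ i j := by
  have hs : ({i, j} : Finset (Fin 2))ᶜ = ∅ := Finset.card_eq_zero.mp (card_compl_pair hij)
  have e₂ := h.sum_pow_two i i
  have t₀ := h.sum_diag
  rw [if_pos rfl] at e₂
  rw [prod_univ_eq_mul_compl_pair hij, hs, Finset.prod_empty, mul_one] at hc t₁
  rw [sum_univ_eq_add_compl_pair hij, hs, Finset.sum_empty, add_zero] at t₁ e₂ t₀
  rw [sum_univ_eq_add_compl_pair hij, hs, Finset.sum_empty, add_zero] at t₀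
  rw [prod_erase_eq_mul_compl_pair hij, prod_erase_eq_mul_compl_pair hij.symm,
    Finset.pair_comm j i, hs, Finset.prod_empty, Finset.prod_empty, mul_one, mul_one]
  have := offDiag_formula_two_aux t₀ t₁ (yb := b i j * b j i) (by
    linear_combination e₂ + hc)
  rw [this, hc]
  rfl

theorem cleared_formula_three {lam : Fin 3 → ℂ} {c : ℂ} {b : Matrix (Fin 3) (Fin 3) ℂ}
    (h : IsBraidMatrix lam c b) (hc : c = (∏ i, lam i) ^ 2)
    (t₁ : ∑ i, lam i * b i i = 0) (t₂ : ∑ i, lam i ^ 2 * b i i = -∏ i, lam i)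
    {i j : Fin 3} (hij : i ≠ j) (γ : ℂ) :
    lam i ^ 2 * lam j ^ 2 * (b i j * b j i) * ((∏ k ∈ Finset.univ.erase i, (lam i - lam k)) *
      ∏ k ∈ Finset.univ.erase j, (lam j - lam k)) = c * braidQ lam γ i j := by
  obtain ⟨k, hs⟩ := Finset.card_eq_one.mp (card_compl_pair hij)
  have e₂ := h.sum_pow_two i i
  have e₃ := h.sum_pow_three i i
  have t₀ := h.sum_diag
  rw [if_pos rfl] at e₂
  simp only [sum_univ_eq_add_compl_pair hij, prod_univ_eq_mul_compl_pair hij,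
    prod_erase_eq_mul_compl_pair hij, prod_erase_eq_mul_compl_pair hij.symm,
    Finset.pair_comm j i, hs, Finset.sum_singleton, Finset.prod_singleton] at hc t₁ t₂ e₂ e₃ t₀ ⊢
  have := offDiag_formula_three_aux (βa := b i i) (yb := b i j * b j i) (yk := b i k * b k i)
    t₀ t₁ (by linear_combination t₂) (by linear_combination e₂ + hc)
    (by linear_combination e₃ + b i i * hc)
  simp only [braidQ, hs, Finset.prod_singleton]
  rw [this, hc]
  ring

theorem cleared_formula_four {lam : Fin 4 → ℂ} {c γ : ℂ} {b : Matrix (Fin 4) (Fin 4) ℂ}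
    (h : IsBraidMatrix lam c b) (hγ : γ ^ 2 = ∏ i, lam i) (hc : c = -γ ^ 3)
    (t₁ : ∑ i, lam i * b i i = -γ) (t₂ : ∑ i, lam i ^ 2 * b i i = 0)
    (t₃ : ∑ i, lam i ^ 3 * b i i = γ ^ 2) {i j : Fin 4} (hij : i ≠ j) :
    lam i ^ 2 * lam j ^ 2 * (b i j * b j i) * ((∏ k ∈ Finset.univ.erase i, (lam i - lam k)) *
      ∏ k ∈ Finset.univ.erase j, (lam j - lam k)) = c * braidQ lam γ i j := by
  obtain ⟨k, l, hkl, hs⟩ := Finset.card_eq_two.mp (card_compl_pair hij)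
  have hγ0 : γ ≠ 0 := by rintro rfl; exact h.ne_zero (by simpa using hc)
  have e₁ := h.sum_pow_one i i
  have e₂ := h.sum_pow_two i i
  have e₃ := h.sum_pow_three i i
  have t₀ := h.sum_diag
  have hoff : ({k, l} : Finset (Fin 4)).offDiag = {(k, l), (l, k)} := by
    clear * - hkl
    ext ⟨x, y⟩
    simp only [Finset.mem_offDiag, Finset.mem_insert, Finset.mem_singleton, Prod.mk.injEq]
    grind
  have hne : ((k, l) : Fin 4 × Fin 4) ≠ (l, k) := by simp [hkl]
  rw [if_pos rfl] at e₂
  simp only [sum_univ_eq_add_compl_pair hij, prod_univ_eq_mul_compl_pair hij,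
    prod_erase_eq_mul_compl_pair hij, prod_erase_eq_mul_compl_pair hij.symm,
    Finset.pair_comm j i, hs, Finset.sum_pair hkl, Finset.prod_pair hkl] at hγ t₁ t₂ t₃ e₁ e₂ e₃ t₀ ⊢
  have := offDiag_formula_four_aux (βa := b i i) (yb := b i j * b j i) (yk := b i k * b k i)
    (yl := b i l * b l i) (h.lam_ne_zero i) (h.lam_ne_zero j) (by linear_combination hγ)
    t₀ t₁ t₂ t₃ (by linear_combination e₁)
    (by linear_combination e₂ + hc) (by linear_combination e₃ + b i i * hc)
  simp only [braidQ, hs, hoff, Finset.prod_pair hne]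
  apply mul_right_cancel₀ hγ0
  rw [hc]
  trans γ ^ 3 * ((lam i ^ 2 + γ) * (lam j ^ 2 + γ) * ((γ + lam i * lam k + lam j * lam l) *
    (γ + lam i * lam l + lam j * lam k)))
  · rw [← this]; ring
  · field_simp

theorem cleared_formula_five {lam : Fin 5 → ℂ} {c γ : ℂ} {b : Matrix (Fin 5) (Fin 5) ℂ}
    (h : IsBraidMatrix lam c b) (hinj : Function.Injective lam)
    (hγ : γ ^ 5 = ∏ i, lam i) (hc : c = γ ^ 6)
    (t₁ : ∑ i, lam i * b i i = -γ ^ 2) (t₂ : ∑ i, lam i ^ 2 * b i i = γ ^ 3)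
    (t₃ : ∑ i, lam i ^ 3 * b i i = -γ ^ 4) {i j : Fin 5} (hij : i ≠ j) :
    lam i ^ 2 * lam j ^ 2 * (b i j * b j i) * ((∏ k ∈ Finset.univ.erase i, (lam i - lam k)) *
      ∏ k ∈ Finset.univ.erase j, (lam j - lam k)) = c * braidQ lam γ i j := by
  -- The elimination divides by λ_i + γ. At most one eigenvalue equals −γ and the formula is
  -- symmetric in i and j, so the roles can be exchanged.
  wlog hi : lam i + γ ≠ 0 generalizing i j
  · have hj : lam j + γ ≠ 0 := by
      intro hj
      rw [not_not] at hi
      exact hij (hinj (add_right_cancel (hi.trans hj.symm)))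
    have := this hij.symm hj
    rw [show braidQ lam γ i j = braidQ lam γ j i by
      simp only [braidQ]
      rw [Finset.pair_comm j i, Finset.prod_congr rfl fun k _ => mul_comm _ _]; ring, ← this]
    ring
  obtain ⟨k, l, n, hkl, hkn, hln, hs⟩ := Finset.card_eq_three.mp (card_compl_pair hij)
  have hγ0 : γ ≠ 0 := by rintro rfl; exact h.ne_zero (by simpa using hc)
  have hk : k ∉ ({l, n} : Finset (Fin 5)) := by simp [hkl, hkn]
  have e₁ := h.sum_pow_one i i
  have e₂ := h.sum_pow_two i i
  have e₃ := h.sum_pow_three i i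
  have e₄ := h.sum_pow_four i i
  have t₀ := h.sum_diag
  have t₄ := h.sum_pow_four_diag
  rw [if_pos rfl] at e₂
  simp only [sum_univ_eq_add_compl_pair hij, prod_univ_eq_mul_compl_pair hij,
    prod_erase_eq_mul_compl_pair hij, prod_erase_eq_mul_compl_pair hij.symm,
    Finset.pair_comm j i, hs, Finset.sum_insert hk, Finset.prod_insert hk, Finset.sum_pair hln,
    Finset.prod_pair hln]
    at hγ t₁ t₂ t₃ e₁ e₂ e₃ e₄ t₀ t₄ ⊢
  have n1 := h.lam_ne_zero i
  have n2 := h.lam_ne_zero j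
  have n3 := h.lam_ne_zero k
  have n4 := h.lam_ne_zero l
  have n5 := h.lam_ne_zero n
  have hsum : c * ((lam i)⁻¹ + ((lam j)⁻¹ + ((lam k)⁻¹ + ((lam l)⁻¹ + (lam n)⁻¹)))) =
      γ * (lam j * lam k * lam l * lam n + lam i * lam k * lam l * lam n +
        lam i * lam j * lam l * lam n + lam i * lam j * lam k * lam n +
        lam i * lam j * lam k * lam l) := by
    rw [hc, show γ ^ 6 = γ * γ ^ 5 by ring, hγ]
    field_simp
    ring
  have := offDiag_formula_five_aux (βa := b i i) (yb := b i j * b j i) (yk := b i k * b k i)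
    (yl := b i l * b l i) (yn := b i n * b n i) n1 n2 hi (by linear_combination hγ)
    t₀ t₁ t₂ t₃ (t₄.trans hsum) (by linear_combination e₁)
    (by linear_combination e₂ + hc) (by linear_combination e₃ + b i i * hc)
    (by linear_combination e₄ +
      (b i i ^ 2 + (b i j * b j i + (b i k * b k i + (b i l * b l i + b i n * b n i)))) * hc)
  simp only [braidQ, hs, Finset.prod_insert hk, Finset.prod_pair hln]
  apply mul_right_cancel₀ (pow_ne_zero 8 hγ0)
  rw [hc]
  trans γ ^ 6 * ((γ ^ 2 + lam i * γ + lam i ^ 2) * (γ ^ 2 + lam j * γ + lam j ^ 2) *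
    ((γ ^ 2 + lam i * lam k) * (γ ^ 2 + lam j * lam k) * ((γ ^ 2 + lam i * lam l) *
      (γ ^ 2 + lam j * lam l) * ((γ ^ 2 + lam i * lam n) * (γ ^ 2 + lam j * lam n)))))
  · rw [← this]; ring
  · field_simp

end IsBraidMatrix

/-! ### Invariance of the formulas under complex conjugation -/

section FormulaReal

/-- Conjugation inverts unimodular numbers, so the homogeneous Q reproduces itself up to a monomial.
The monomial is written in one shape for all d because the denominator of `muFormula` acquires
exactly the same factor. -/
theorem conj_braidQ_two {lam : Fin 2 → ℂ} (hlam : ∀ i, lam i * conj (lam i) = 1) (γ : ℂ)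
    {i j : Fin 2} (hij : i ≠ j) :
    conj (braidQ lam γ i j) =
      braidQ lam γ i j * ((conj (lam i) * conj (lam j)) ^ (2 - 2) * conj (∏ k, lam k) ^ 2) := by
  have hs : ({i, j} : Finset (Fin 2))ᶜ = ∅ := Finset.card_eq_zero.mp (card_compl_pair hij)
  rw [prod_univ_eq_mul_compl_pair hij, hs, Finset.prod_empty, mul_one]
  simp only [braidQ, map_mul, map_add, map_sub, map_neg, map_pow]
  have h1 := hlam i
  have h2 := hlam j
  generalize conj (lam i) = A at *
  generalize conj (lam j) = B at *
  linear_combination B ^ 2 * (lam i * A + 1) * h1 - A * B * lam j * B * h1 - A * B * h2 +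
    A ^ 2 * (lam j * B + 1) * h2

theorem conj_braidQ_three {lam : Fin 3 → ℂ} (hlam : ∀ i, lam i * conj (lam i) = 1) (γ : ℂ)
    {i j : Fin 3} (hij : i ≠ j) :
    conj (braidQ lam γ i j) =
      braidQ lam γ i j * ((conj (lam i) * conj (lam j)) ^ (3 - 2) * conj (∏ k, lam k) ^ 2) := by
  obtain ⟨k, hs⟩ := Finset.card_eq_one.mp (card_compl_pair hij)
  have factor : ∀ a b k A B K : ℂ, a * A = 1 → b * B = 1 → k * K = 1 →
      A ^ 2 + B * K = (a ^ 2 + b * k) * (A ^ 2 * B * K) := by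
    intro a b k A B K ha hb hk
    linear_combination -B * K * (a * A + 1) * ha - A ^ 2 * k * K * hb - A ^ 2 * hk
  rw [prod_univ_eq_mul_compl_pair hij, hs, Finset.prod_singleton]
  simp only [braidQ, hs, Finset.prod_singleton, map_mul, map_add, map_pow]
  rw [factor _ _ _ _ _ _ (hlam i) (hlam j) (hlam k),
    factor _ _ _ _ _ _ (hlam j) (hlam i) (hlam k)]
  ring

theorem conj_braidQ_four {lam : Fin 4 → ℂ} (hlam : ∀ i, lam i * conj (lam i) = 1) {γ : ℂ}
    (hγ : γ * conj γ = 1) (hγ2 : γ ^ 2 = ∏ k, lam k) {i j : Fin 4} (hij : i ≠ j) :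
    conj (braidQ lam γ i j) =
      braidQ lam γ i j * ((conj (lam i) * conj (lam j)) ^ (4 - 2) * conj (∏ k, lam k) ^ 2) := by
  have hG2 : conj γ ^ 2 = conj (∏ k, lam k) := by rw [← hγ2, map_pow]
  -- Since γ² is the product of all eigenvalues, conjugation exchanges the two quadratic terms up to
  -- the factor conj γ².
  have hp : ∀ p ∈ (({i, j} : Finset (Fin 4))ᶜ).offDiag,
      conj (γ + lam i * lam p.1 + lam j * lam p.2) =
        (γ + lam i * lam p.1 + lam j * lam p.2) * conj γ ^ 2 := by
    intro p hp
    obtain ⟨h1, h2, h3⟩ := Finset.mem_offDiag.mp hp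
    have hs : ({i, j} : Finset (Fin 4))ᶜ = {p.1, p.2} := by
      symm
      apply Finset.eq_of_subset_of_card_le
      · intro x hx
        rcases Finset.mem_insert.mp hx with rfl | hx
        · exact h1
        · rw [Finset.mem_singleton.mp hx]; exact h2
      · rw [card_compl_pair hij, Finset.card_pair h3]
    rw [prod_univ_eq_mul_compl_pair hij, hs, Finset.prod_pair h3] at hG2
    simp only [map_mul, map_add] at hG2 ⊢
    have e1 := hlam i
    have e2 := hlam j
    have e3 := hlam p.1
    have e4 := hlam p.2
    linear_combination -conj γ * hγ - (lam i * lam p.1 + lam j * lam p.2) * hG2 -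
      conj (lam j) * conj (lam p.2) * (lam p.1 * conj (lam p.1) * e1 + e3) -
      conj (lam i) * conj (lam p.1) * (lam p.2 * conj (lam p.2) * e2 + e4)
  have factor : ∀ a A : ℂ, a * A = 1 → A ^ 2 + conj γ = (a ^ 2 + γ) * (A ^ 2 * conj γ) := by
    intro a A ha
    linear_combination -conj γ * (a * A + 1) * ha - A ^ 2 * hγ
  have hinv : γ⁻¹ = conj γ := inv_eq_of_mul_eq_one_right hγ
  have hcard : (({i, j} : Finset (Fin 4))ᶜ).offDiag.card = 2 := by
    rw [Finset.offDiag_card, card_compl_pair hij]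
  simp only [braidQ, map_mul, map_add, map_pow, map_neg, map_prod conj _ (Finset.offDiag _), hinv,
    Complex.conj_conj]
  rw [Finset.prod_congr rfl fun p h => (by simpa using hp p h),
    Finset.prod_mul_distrib, Finset.prod_const, hcard, factor _ _ (hlam i), factor _ _ (hlam j),
    ← hG2]
  generalize ∏ p ∈ (({i, j} : Finset (Fin 4))ᶜ).offDiag, (γ + lam i * lam p.1 + lam j * lam p.2)
    = X
  generalize lam i ^ 2 + γ = Y
  generalize lam j ^ 2 + γ = Z
  linear_combination -(conj γ) ^ 5 * conj (lam i) ^ 2 * conj (lam j) ^ 2 * X * Y * Z * hγ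

theorem conj_braidQ_five {lam : Fin 5 → ℂ} (hlam : ∀ i, lam i * conj (lam i) = 1) {γ : ℂ}
    (hγ : γ * conj γ = 1) {i j : Fin 5} (hij : i ≠ j) :
    conj (braidQ lam γ i j) =
      braidQ lam γ i j * ((conj (lam i) * conj (lam j)) ^ (5 - 2) * conj (∏ k, lam k) ^ 2) := by
  have pair : ∀ a b A B : ℂ, a * A = 1 → b * B = 1 →
      conj γ ^ 2 + A * B = (γ ^ 2 + a * b) * (conj γ ^ 2 * A * B) := by
    intro a b A B ha hb
    linear_combination -A * B * (γ * conj γ + 1) * hγ - conj γ ^ 2 * b * B * ha - conj γ ^ 2 * hb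
  have factor : ∀ a A : ℂ, a * A = 1 → conj γ ^ 2 + A * conj γ + A ^ 2 =
      (γ ^ 2 + a * γ + a ^ 2) * (conj γ ^ 2 * A ^ 2) := by
    intro a A ha
    linear_combination -A ^ 2 * (γ * conj γ + 1) * hγ - A * conj γ * a * A * hγ - A * conj γ * ha -
      conj γ ^ 2 * (a * A + 1) * ha
  have hinv : (γ ^ 8)⁻¹ = conj γ ^ 8 := inv_eq_of_mul_eq_one_right (by rw [← mul_pow, hγ, one_pow])
  have hk : ∀ k ∈ ({i, j} : Finset (Fin 5))ᶜ,
      (conj γ ^ 2 + conj (lam i) * conj (lam k)) * (conj γ ^ 2 + conj (lam j) * conj (lam k)) =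
      ((γ ^ 2 + lam i * lam k) * (γ ^ 2 + lam j * lam k)) *
        ((conj γ ^ 4 * conj (lam i) * conj (lam j)) * conj (lam k) ^ 2) := by
    intro k _
    rw [pair _ _ _ _ (hlam i) (hlam k), pair _ _ _ _ (hlam j) (hlam k)]
    ring
  have hprod : ∏ k ∈ ({i, j} : Finset (Fin 5))ᶜ,
      ((conj γ ^ 2 + conj (lam i) * conj (lam k)) * (conj γ ^ 2 + conj (lam j) * conj (lam k))) =
      (∏ k ∈ ({i, j} : Finset (Fin 5))ᶜ, ((γ ^ 2 + lam i * lam k) * (γ ^ 2 + lam j * lam k))) *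
        ((conj γ ^ 4 * conj (lam i) * conj (lam j)) ^ 3 *
          (∏ k ∈ ({i, j} : Finset (Fin 5))ᶜ, conj (lam k)) ^ 2) := by
    have hcard : ({i, j} : Finset (Fin 5))ᶜ.card = 3 := card_compl_pair hij
    generalize ({i, j} : Finset (Fin 5))ᶜ = s at *
    rw [Finset.prod_congr rfl hk, Finset.prod_mul_distrib]
    congr 1
    rw [Finset.prod_mul_distrib, Finset.prod_const, hcard, Finset.prod_pow]
  rw [prod_univ_eq_mul_compl_pair hij]
  simp only [braidQ, map_mul, map_add, map_pow, map_prod, hinv, Complex.conj_conj]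
  rw [hprod, factor _ _ (hlam i), factor _ _ (hlam j)]
  generalize ∏ k ∈ ({i, j} : Finset (Fin 5))ᶜ, ((γ ^ 2 + lam i * lam k) * (γ ^ 2 + lam j * lam k))
    = X
  generalize ∏ k ∈ ({i, j} : Finset (Fin 5))ᶜ, conj (lam k) = W
  generalize γ ^ 2 + lam i * γ + lam i ^ 2 = Y
  generalize γ ^ 2 + lam j * γ + lam j ^ 2 = Z
  have h8 : γ ^ 8 * conj γ ^ 8 = 1 := by rw [← mul_pow, hγ, one_pow]
  linear_combination conj γ ^ 8 * conj (lam i) ^ 5 * conj (lam j) ^ 5 * W ^ 2 * X * Y * Z * h8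

theorem conj_prod_erase {d : ℕ} {lam : Fin d → ℂ} (hlam : ∀ i, lam i * conj (lam i) = 1)
    (i : Fin d) :
    conj (∏ k ∈ Finset.univ.erase i, (lam i - lam k)) =
      (∏ k ∈ Finset.univ.erase i, (lam i - lam k)) *
        ((-conj (lam i)) ^ (d - 1) * (lam i * conj (∏ k, lam k))) := by
  have h1 : ∀ k ∈ Finset.univ.erase i, conj (lam i - lam k) =
      (lam i - lam k) * (-conj (lam i) * conj (lam k)) := by
    intro k _
    rw [map_sub]
    linear_combination conj (lam k) * hlam i - conj (lam i) * hlam k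
  have h2 : lam i * conj (∏ k, lam k) = ∏ k ∈ Finset.univ.erase i, conj (lam k) := by
    rw [← Finset.mul_prod_erase _ _ (Finset.mem_univ i), map_mul, map_prod, ← mul_assoc, hlam,
      one_mul]
  rw [map_prod, Finset.prod_congr rfl h1, Finset.prod_mul_distrib, Finset.prod_mul_distrib,
    Finset.prod_const, Finset.card_erase_of_mem (Finset.mem_univ i), Finset.card_univ,
    Fintype.card_fin, h2]

theorem prod_erase_sub_ne_zero {d : ℕ} {lam : Fin d → ℂ} (hinj : Function.Injective lam)
    (i : Fin d) : ∏ k ∈ Finset.univ.erase i, (lam i - lam k) ≠ 0 :=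
  Finset.prod_ne_zero_iff.mpr fun _ hk =>
    sub_ne_zero.mpr (hinj.ne (Finset.ne_of_mem_erase hk).symm)

theorem conj_muFormula {d : ℕ} (hd : 2 ≤ d) {lam : Fin d → ℂ}
    (hlam : ∀ i, lam i * conj (lam i) = 1) {γ : ℂ} {i j : Fin d}
    (hQ : conj (braidQ lam γ i j) =
      braidQ lam γ i j * ((conj (lam i) * conj (lam j)) ^ (d - 2) * conj (∏ k, lam k) ^ 2)) :
    conj (muFormula lam γ i j) = muFormula lam γ i j := by
  have hc : ∀ i, conj (lam i) ≠ 0 := fun i => right_ne_zero_of_mul_eq_one (hlam i)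
  have hM : (conj (lam i) * conj (lam j)) ^ (d - 2) * conj (∏ k, lam k) ^ 2 ≠ 0 := by
    rw [map_prod]
    exact mul_ne_zero (pow_ne_zero _ (mul_ne_zero (hc i) (hc j)))
      (pow_ne_zero _ (Finset.prod_ne_zero_iff.mpr fun k _ => hc k))
  rw [muFormula, map_div₀, map_mul, conj_prod_erase hlam, conj_prod_erase hlam, hQ,
    ← mul_div_mul_right (braidQ lam γ i j) _ hM]
  congr 1
  obtain ⟨m, rfl⟩ : ∃ m, d = m + 2 := ⟨d - 2, by omega⟩
  simp only [Nat.add_sub_cancel, show m + 2 - 1 = m + 1 from rfl]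
  have e : (-conj (lam i)) ^ (m + 1) * (-conj (lam j)) ^ (m + 1) =
      (conj (lam i) * conj (lam j)) ^ (m + 1) := by rw [← mul_pow, neg_mul_neg]
  have e1 : conj (lam i) * conj (lam j) * (lam i * lam j) = 1 := by
    linear_combination lam j * conj (lam j) * hlam i + hlam j
  generalize ∏ k ∈ Finset.univ.erase i, (lam i - lam k) = X
  generalize ∏ k ∈ Finset.univ.erase j, (lam j - lam k) = Y
  rw [pow_succ] at e
  linear_combination X * Y * lam i * lam j * conj (∏ k, lam k) ^ 2 * e +
    X * Y * conj (∏ k, lam k) ^ 2 * (conj (lam i) * conj (lam j)) ^ m * e1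

end FormulaReal

/-! ### Passage from operators to matrices in an eigenbasis -/

section Eigenbasis

variable {d : ℕ} {V : Type*} [AddCommGroup V] [Module ℂ V] {A B : Module.End ℂ V} {c : ℂ}
  {lam : Fin d → ℂ} (v : Module.Basis (Fin d) ℂ V)

theorem toMatrix_eq_diagonal (hv : ∀ i, A (v i) = lam i • v i) :
    LinearMap.toMatrix v v A = Matrix.diagonal lam := by
  ext i j
  rw [LinearMap.toMatrix_apply, hv, map_smul]
  by_cases hij : i = j
  · subst hij; simp
  · simp [hij]

theorem IsBraidPair.isBraidMatrix (h : IsBraidPair A B c) (hv : ∀ i, A (v i) = lam i • v i)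
    (hlam : ∀ i, lam i ≠ 0) : IsBraidMatrix lam c (LinearMap.toMatrix v v B) where
  lam_ne_zero := hlam
  ne_zero := h.ne_zero
  braid := by
    rw [← toMatrix_eq_diagonal v hv]
    simp only [← LinearMap.toMatrix_mul]
    rw [h.braid]
  sq := by
    rw [← toMatrix_eq_diagonal v hv]
    simp only [← LinearMap.toMatrix_mul]
    rw [h.sq, map_smul, LinearMap.toMatrix_one]

theorem det_eq_prod_eigenvalues (hv : ∀ i, A (v i) = lam i • v i) :
    LinearMap.det A = ∏ i, lam i := by
  rw [← LinearMap.det_toMatrix v, toMatrix_eq_diagonal v hv, Matrix.det_diagonal]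

theorem sum_diag_eq_trace (hv : ∀ i, A (v i) = lam i • v i) :
    ∑ i, lam i * LinearMap.toMatrix v v B i i = LinearMap.trace ℂ V (A * B) := by
  rw [LinearMap.trace_eq_matrix_trace ℂ v, LinearMap.toMatrix_mul, toMatrix_eq_diagonal v hv,
    Matrix.trace]
  simp

theorem sum_sq_diag_eq_trace (hv : ∀ i, A (v i) = lam i • v i) :
    ∑ i, lam i ^ 2 * LinearMap.toMatrix v v B i i = LinearMap.trace ℂ V (A * B * A) := by
  rw [LinearMap.trace_eq_matrix_trace ℂ v, LinearMap.toMatrix_mul, LinearMap.toMatrix_mul,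
    toMatrix_eq_diagonal v hv, Matrix.trace]
  refine Finset.sum_congr rfl fun i _ => ?_
  rw [Matrix.diag_apply, Matrix.mul_diagonal, Matrix.diagonal_mul]
  ring

theorem IsBraidPair.sum_cube_diag_eq_trace (h : IsBraidPair A B c)
    (hv : ∀ i, A (v i) = lam i • v i) :
    ∑ i, lam i ^ 3 * LinearMap.toMatrix v v B i i = LinearMap.trace ℂ V (A * B * (A * B)) := by
  have h1 : A * B * (A * B) = A * A * B * A := by
    rw [show A * B * (A * B) = A * (B * A * B) by noncomm_ring, ← h.braid]
    noncomm_ring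
  rw [h1, LinearMap.trace_eq_matrix_trace ℂ v, LinearMap.toMatrix_mul, LinearMap.toMatrix_mul,
    LinearMap.toMatrix_mul, toMatrix_eq_diagonal v hv, Matrix.trace]
  refine Finset.sum_congr rfl fun i _ => ?_
  rw [Matrix.diag_apply, Matrix.mul_diagonal, Matrix.diagonal_mul_diagonal, Matrix.diagonal_mul]
  ring

theorem toMatrix_half_twist_apply (hv : ∀ i, A (v i) = lam i • v i) (i j : Fin d) :
    LinearMap.toMatrix v v (A * B * A) i j = lam i * LinearMap.toMatrix v v B i j * lam j := by
  rw [LinearMap.toMatrix_mul, LinearMap.toMatrix_mul, toMatrix_eq_diagonal v hv,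
    Matrix.mul_diagonal, Matrix.diagonal_mul]

/-- A set of coordinates spanning an invariant subspace is everything. -/
theorem JointlyIrreducible.eq_univ_of_entry_eq_zero (hirr : JointlyIrreducible A B)
    (hv : ∀ i, A (v i) = lam i • v i) (J : Set (Fin d)) (hJ : J.Nonempty)
    (hzero : ∀ k ∈ J, ∀ j ∉ J, LinearMap.toMatrix v v B j k = 0) : J = Set.univ := by
  have inv : ∀ C : Module.End ℂ V, (∀ k ∈ J, C (v k) ∈ Submodule.span ℂ (v '' J)) →
      ∀ x ∈ Submodule.span ℂ (v '' J), C x ∈ Submodule.span ℂ (v '' J) := by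
    intro C hC x hx
    have : Submodule.span ℂ (v '' J) ≤ (Submodule.span ℂ (v '' J)).comap C := by
      rw [Submodule.span_le]
      rintro _ ⟨k, hk, rfl⟩
      exact hC k hk
    exact this hx
  have hmem : ∀ k ∈ J, v k ∈ Submodule.span ℂ (v '' J) := fun k hk =>
    Submodule.subset_span ⟨k, hk, rfl⟩
  rcases hirr (Submodule.span ℂ (v '' J))
    (inv A fun k hk => by rw [hv]; exact Submodule.smul_mem _ _ (hmem k hk))
    (inv B fun k hk => by
      rw [← v.sum_repr (B (v k))]
      refine Submodule.sum_mem _ fun j _ => ?_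
      by_cases hj : j ∈ J
      · exact Submodule.smul_mem _ _ (hmem j hj)
      · rw [← LinearMap.toMatrix_apply, hzero k hk j hj, zero_smul]
        exact Submodule.zero_mem _) with h0 | h0
  · obtain ⟨k, hk⟩ := hJ
    have := hmem k hk
    rw [h0, Submodule.mem_bot] at this
    exact absurd this (v.ne_zero k)
  · rw [Set.eq_univ_iff_forall]
    intro i
    have : v i ∈ Submodule.span ℂ (v '' J) := h0 ▸ Submodule.mem_top
    exact v.mem_span_image.mp this (by simp)

theorem toMatrix_eigenProj (hinj : Function.Injective lam) (hv : ∀ i, A (v i) = lam i • v i)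
    (i : Fin d) : LinearMap.toMatrix v v (eigenProj A lam i) = Matrix.single i i 1 := by
  ext k j
  rw [LinearMap.toMatrix_apply, eigenProj, Module.End.aeval_apply_of_mem_apply_eq_smul (hv j),
    map_smul]
  by_cases hij : i = j
  · subst hij
    rw [Lagrange.eval_basis_self hinj.injOn (Finset.mem_univ i)]
    by_cases hk : i = k
    · subst hk; simp
    · simp [hk, Ne.symm hk]
  · rw [Lagrange.eval_basis_of_ne hij (Finset.mem_univ j)]
    simp [hij]

theorem IsBraidPair.aeval_mul_half_twist (h : IsBraidPair A B c) (p : Polynomial ℂ) :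
    Polynomial.aeval B p * (A * B * A) = A * B * A * Polynomial.aeval A p := by
  have hs : SemiconjBy (A * B * A) A B := h.semiconj
  induction p using Polynomial.induction_on' with
  | add p q hp hq => rw [map_add, map_add, add_mul, mul_add, hp, hq]
  | monomial n a =>
    rw [Polynomial.aeval_monomial, Polynomial.aeval_monomial]
    simp only [Algebra.algebraMap_eq_smul_one, smul_mul_assoc, mul_smul_comm, one_mul]
    rw [(hs.pow_right n).eq]

/-- This is e_{B,i} = S e_{A,i} S⁻¹, with S⁻¹ = S/c. -/
theorem IsBraidPair.smul_eigenProj (h : IsBraidPair A B c) (i : Fin d) :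
    c • eigenProj B lam i = A * B * A * eigenProj A lam i * (A * B * A) := by
  rw [eigenProj, eigenProj, ← h.aeval_mul_half_twist, mul_assoc, h.sq, mul_smul_comm, mul_one]

/-- Needed for uniqueness of μ: it permits comparing coefficients of e_{B,i}. -/
theorem IsBraidPair.eigenProj_ne_zero (h : IsBraidPair A B c) (hinj : Function.Injective lam)
    (hv : ∀ i, A (v i) = lam i • v i) (i : Fin d) : eigenProj B lam i ≠ 0 := by
  intro h0
  have h1 := h.smul_eigenProj (lam := lam) i
  rw [h0, smul_zero] at h1
  have h2 : (A * B * A) * ((A * B * A) * eigenProj A lam i * (A * B * A)) * (A * B * A) =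
      (c * c) • eigenProj A lam i := by
    rw [show (A * B * A) * ((A * B * A) * eigenProj A lam i * (A * B * A)) * (A * B * A) =
      ((A * B * A) * (A * B * A)) * eigenProj A lam i * ((A * B * A) * (A * B * A)) by
        noncomm_ring, h.sq]
    simp [smul_smul]
  rw [← h1, mul_zero, zero_mul] at h2
  have h3 := (smul_eq_zero.mp h2.symm).resolve_left (mul_ne_zero h.ne_zero h.ne_zero)
  have h4 := toMatrix_eigenProj v hinj hv i
  rw [h3, map_zero] at h4
  simpa using congrFun (congrFun h4 i) i

/-- Conjugating by S turns the product into e_{A,i} S e_{A,j} S e_{A,i}; with matrix units in place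
of the projections this is S_ij S_ji e_{A,i}. -/
theorem IsBraidPair.eigenProj_mul_mul (h : IsBraidPair A B c) (hinj : Function.Injective lam)
    (hv : ∀ i, A (v i) = lam i • v i) (i j : Fin d) :
    c • (eigenProj B lam i * eigenProj A lam j * eigenProj B lam i) =
      (lam i ^ 2 * lam j ^ 2 * (LinearMap.toMatrix v v B i j * LinearMap.toMatrix v v B j i)) •
        eigenProj B lam i := by
  obtain ⟨S, hS⟩ : ∃ S, S = A * B * A := ⟨_, rfl⟩
  have h1 : eigenProj A lam i * S * eigenProj A lam j * S * eigenProj A lam i =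
      (lam i ^ 2 * lam j ^ 2 * (LinearMap.toMatrix v v B i j * LinearMap.toMatrix v v B j i)) •
        eigenProj A lam i := by
    apply (LinearMap.toMatrix v v).injective
    rw [map_smul]
    simp only [LinearMap.toMatrix_mul, toMatrix_eigenProj v hinj hv]
    rw [Matrix.single_mul_mul_single, Matrix.single_mul_mul_single, hS,
      toMatrix_half_twist_apply v hv, toMatrix_half_twist_apply v hv, Matrix.smul_single]
    congr 1
    rw [smul_eq_mul]
    ring
  have h2 := h.smul_eigenProj (lam := lam) i
  rw [← hS] at h2
  have hcc : c * c ≠ 0 := mul_ne_zero h.ne_zero h.ne_zero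
  have h3 : (c * c) • (eigenProj B lam i * eigenProj A lam j * eigenProj B lam i) =
      (lam i ^ 2 * lam j ^ 2 * (LinearMap.toMatrix v v B i j * LinearMap.toMatrix v v B j i)) •
        c • eigenProj B lam i := by
    calc _ = (c • eigenProj B lam i) * eigenProj A lam j * (c • eigenProj B lam i) := by
          simp only [smul_mul_assoc, mul_smul_comm, smul_smul]
      _ = S * (eigenProj A lam i * S * eigenProj A lam j * S * eigenProj A lam i) * S := by
          rw [h2]; noncomm_ring
      _ = _ := by rw [h1, h2]; simp only [smul_mul_assoc, mul_smul_comm]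
  rw [mul_smul, smul_comm (_ * _) c] at h3
  exact smul_right_injective _ h.ne_zero h3

end Eigenbasis

/-! ### Invariant inner products -/

section Unitarity

variable {d : ℕ} {V : Type*} [AddCommGroup V] [Module ℂ V]

/-- The Hermitian form with the given weights on a basis, as an inner product. -/
@[reducible] noncomputable def weightedCore (v : Module.Basis (Fin d) ℂ V) (w : Fin d → ℝ) (hw : ∀ i, 0 < w i) :
    InnerProductSpace.Core ℂ V where
  inner x y := ∑ i, (w i : ℂ) * (conj (v.repr x i) * v.repr y i)
  conj_inner_symm x y := by
    rw [map_sum]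
    refine Finset.sum_congr rfl fun i _ => ?_
    rw [map_mul, map_mul, Complex.conj_ofReal, Complex.conj_conj]
    ring
  re_inner_nonneg x := by
    rw [map_sum]
    refine Finset.sum_nonneg fun i _ => ?_
    rw [← Complex.normSq_eq_conj_mul_self, ← Complex.ofReal_mul]
    exact mul_nonneg (hw i).le (Complex.normSq_nonneg _)
  add_left x y z := by
    rw [← Finset.sum_add_distrib]
    refine Finset.sum_congr rfl fun i _ => ?_
    rw [map_add, Finsupp.add_apply, map_add]
    ring
  smul_left x y r := by
    rw [Finset.mul_sum]
    refine Finset.sum_congr rfl fun i _ => ?_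
    rw [map_smul, Finsupp.smul_apply, smul_eq_mul, map_mul]
    ring
  definite x hx := by
    have h1 : ∑ i, w i * Complex.normSq (v.repr x i) = 0 := by
      apply Complex.ofReal_injective
      rw [Complex.ofReal_sum, Complex.ofReal_zero, ← hx]
      refine Finset.sum_congr rfl fun i _ => ?_
      rw [Complex.ofReal_mul, Complex.normSq_eq_conj_mul_self]
    rw [Finset.sum_eq_zero_iff_of_nonneg
      fun i _ => mul_nonneg (hw i).le (Complex.normSq_nonneg _)] at h1
    apply v.repr.map_eq_zero_iff.mp
    ext i
    have h2 := (mul_eq_zero.mp (h1 i (Finset.mem_univ i))).resolve_left (hw i).ne'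
    simpa using h2

theorem weightedCore_inner (v : Module.Basis (Fin d) ℂ V) (w : Fin d → ℝ) (hw : ∀ i, 0 < w i)
    (x y : V) : (weightedCore v w hw).inner x y =
      ∑ i, (w i : ℂ) * (conj (v.repr x i) * v.repr y i) := rfl

theorem InnerProductSpace.Core.inner_smul_right' (ip : InnerProductSpace.Core ℂ V) (x y : V)
    (r : ℂ) : ip.inner x (r • y) = r * ip.inner x y := by
  rw [← ip.conj_inner_symm, ip.smul_left, map_mul, Complex.conj_conj, ip.conj_inner_symm]

theorem InnerProductSpace.Core.inner_add_right' (ip : InnerProductSpace.Core ℂ V) (x y z : V) :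
    ip.inner x (y + z) = ip.inner x y + ip.inner x z := by
  rw [← ip.conj_inner_symm, ip.add_left, map_add, ip.conj_inner_symm, ip.conj_inner_symm]

/-- A form preserved by the first generator and the half twist is preserved by the group. -/
theorem isUnitarizable_of_half_twist (ρ : Representation ℂ BraidGroup3 V)
    (ip : InnerProductSpace.Core ℂ V)
    (hA : ∀ x y, ip.inner (ρ sigma1 x) (ρ sigma1 y) = ip.inner x y)
    (hS : ∀ x y, ip.inner ((ρ sigma1 * ρ sigma2 * ρ sigma1) x)
      ((ρ sigma1 * ρ sigma2 * ρ sigma1) y) = ip.inner x y) : IsUnitarizable ρ := by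
  refine ⟨ip, fun g => ?_⟩
  have cancel : ∀ (g : BraidGroup3) (x : V), ρ g (ρ g⁻¹ x) = x := fun g x => by simp
  induction g using braidGroup3_induction with
  | h1 => exact hA
  | h2 =>
    intro x y
    -- The second generator is A⁻¹ S A⁻¹.
    have h := hS (ρ sigma1⁻¹ x) (ρ sigma1⁻¹ y)
    simp only [Module.End.mul_apply, cancel] at h
    rw [hA, ← hA (ρ sigma1⁻¹ x), cancel, cancel] at h
    exact h
  | one => simp
  | mul x y hx hy => intro u v; rw [map_mul, Module.End.mul_apply, Module.End.mul_apply, hx, hy]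
  | inv g hg => intro u v; rw [← hg, cancel, cancel]

/-- The relation on the weights says ⟨x, Sy⟩ = c⟨Sx, y⟩. Replacing y by Sy and using S² = c makes S
unitary; A is diagonal with unimodular entries. -/
theorem isUnitarizable_of_weights (ρ : Representation ℂ BraidGroup3 V) {c : ℂ} {lam : Fin d → ℂ}
    (v : Module.Basis (Fin d) ℂ V) (h : IsBraidPair (ρ sigma1) (ρ sigma2) c)
    (hv : ∀ i, ρ sigma1 (v i) = lam i • v i) (hlam : ∀ i, lam i * conj (lam i) = 1)
    (w : Fin d → ℝ) (hw : ∀ i, 0 < w i)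
    (hrel : ∀ i j, (w i : ℂ) * (lam i * lam j) ^ 2 * LinearMap.toMatrix v v (ρ sigma2) i j =
      c * conj (LinearMap.toMatrix v v (ρ sigma2) j i) * w j) : IsUnitarizable ρ := by
  obtain ⟨S, hS⟩ : ∃ S, S = ρ sigma1 * ρ sigma2 * ρ sigma1 := ⟨_, rfl⟩
  have hrepr : ∀ (C : Module.End ℂ V) (x : V) (i : Fin d),
      v.repr (C x) i = ∑ j, LinearMap.toMatrix v v C i j * v.repr x j := by
    intro C x i
    rw [← LinearMap.toMatrix_mulVec_repr v v]
    rfl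
  have hrel' : ∀ i j, (w i : ℂ) * LinearMap.toMatrix v v S i j =
      c * conj (LinearMap.toMatrix v v S j i) * w j := by
    intro i j
    rw [hS, toMatrix_half_twist_apply v hv, toMatrix_half_twist_apply v hv, map_mul, map_mul]
    linear_combination conj (lam i) * conj (lam j) * hrel i j -
      w i * lam i * lam j * LinearMap.toMatrix v v (ρ sigma2) i j *
        (lam i * conj (lam i) * hlam j + hlam i)
  have hadj : ∀ x y, (weightedCore v w hw).inner x (S y) =
      c * (weightedCore v w hw).inner (S x) y := by
    intro x y
    simp only [weightedCore_inner, hrepr S, map_sum, map_mul, Finset.sum_mul, Finset.mul_sum]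
    rw [Finset.sum_comm]
    refine Finset.sum_congr rfl fun j _ => Finset.sum_congr rfl fun i _ => ?_
    linear_combination conj (v.repr x i) * v.repr y j * hrel' i j
  refine isUnitarizable_of_half_twist ρ (weightedCore v w hw) (fun x y => ?_) fun x y => ?_
  · have hA : ∀ x i, v.repr (ρ sigma1 x) i = lam i * v.repr x i := by
      intro x i
      rw [hrepr, toMatrix_eq_diagonal v hv]
      simp [Matrix.diagonal_apply]
    rw [weightedCore_inner, weightedCore_inner]
    refine Finset.sum_congr rfl fun i _ => ?_
    rw [hA, hA, map_mul]
    linear_combination w i * conj (v.repr x i) * v.repr y i * hlam i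
  · rw [← hS]
    apply mul_left_cancel₀ h.ne_zero
    rw [← hadj, ← Module.End.mul_apply, hS, h.sq, LinearMap.smul_apply, Module.End.one_apply,
      InnerProductSpace.Core.inner_smul_right']

/-- Eigenvectors of the unitary A are orthogonal, with squared lengths r and s at i and j. From S* =
S/c one gets S_ij r = c · conj(S_ji) s, hence μ r = |S_ji|² s. -/
theorem IsUnitarizable.mu_pos {ρ : Representation ℂ BraidGroup3 V} (hu : IsUnitarizable ρ) {c : ℂ}
    {lam : Fin d → ℂ} (v : Module.Basis (Fin d) ℂ V) (h : IsBraidPair (ρ sigma1) (ρ sigma2) c)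
    (hinj : Function.Injective lam)
    (hv : ∀ i, ρ sigma1 (v i) = lam i • v i) (hlam : ∀ i, lam i * conj (lam i) = 1)
    {i j : Fin d} (hne : LinearMap.toMatrix v v (ρ sigma2) j i ≠ 0) {μ : ℝ}
    (hμ : lam i ^ 2 * lam j ^ 2 * (LinearMap.toMatrix v v (ρ sigma2) i j *
      LinearMap.toMatrix v v (ρ sigma2) j i) = c * μ) : 0 < μ := by
  obtain ⟨ip, hip⟩ := hu
  obtain ⟨S, hS⟩ : ∃ S, S = ρ sigma1 * ρ sigma2 * ρ sigma1 := ⟨_, rfl⟩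
  have hSip : ∀ x y, ip.inner (S x) (S y) = ip.inner x y := by
    intro x y
    rw [hS, ← map_mul, ← map_mul]
    exact hip _ x y
  have horth : ∀ k l, k ≠ l → ip.inner (v k) (v l) = 0 := by
    intro k l hkl
    have h1 := hip sigma1 (v k) (v l)
    rw [hv, hv, ip.smul_left, InnerProductSpace.Core.inner_smul_right'] at h1
    have h2 : (lam l - lam k) * ip.inner (v k) (v l) = 0 := by
      linear_combination lam k * h1 - lam l * ip.inner (v k) (v l) * hlam k
    exact (mul_eq_zero.mp h2).resolve_left (sub_ne_zero.mpr (hinj.ne hkl.symm))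
  have hnorm : ∀ k, ∃ r : ℝ, 0 < r ∧ ip.inner (v k) (v k) = r := by
    intro k
    have h1 : ip.inner (v k) (v k) = ((ip.inner (v k) (v k)).re : ℂ) :=
      (Complex.conj_eq_iff_re.mp (ip.conj_inner_symm (v k) (v k))).symm
    refine ⟨(ip.inner (v k) (v k)).re, ?_, h1⟩
    refine lt_of_le_of_ne (ip.re_inner_nonneg (v k)) fun h0 => v.ne_zero k (ip.definite _ ?_)
    rw [h1, ← h0, Complex.ofReal_zero]
  have hentry : ∀ k l, ip.inner (v k) (S (v l)) =
      LinearMap.toMatrix v v S k l * ip.inner (v k) (v k) := by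
    intro k l
    let φ : V →ₗ[ℂ] ℂ :=
      { toFun := ip.inner (v k)
        map_add' := InnerProductSpace.Core.inner_add_right' ip (v k)
        map_smul' := fun r y => InnerProductSpace.Core.inner_smul_right' ip (v k) y r }
    have h1 : φ (S (v l)) = ∑ m, v.repr (S (v l)) m * φ (v m) := by
      conv_lhs => rw [← v.sum_repr (S (v l))]
      simp only [map_sum, map_smul, smul_eq_mul]
    rw [Finset.sum_eq_single_of_mem k (Finset.mem_univ k)
      fun m _ hm => by
        rw [show φ (v m) = 0 from horth k m hm.symm, mul_zero]] at h1
    rw [LinearMap.toMatrix_apply]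
    exact h1
  obtain ⟨r, hr, hri⟩ := hnorm i
  obtain ⟨s, hs, hsj⟩ := hnorm j
  have hrel : LinearMap.toMatrix v v S i j * r = c * (conj (LinearMap.toMatrix v v S j i) * s) := by
    rw [← hri, ← hentry, ← Complex.conj_ofReal s, ← map_mul, ← hsj, ← hentry, ip.conj_inner_symm,
      ← hSip, ← Module.End.mul_apply, hS, h.sq, LinearMap.smul_apply, Module.End.one_apply,
      InnerProductSpace.Core.inner_smul_right']
  have hμ' : LinearMap.toMatrix v v S i j * LinearMap.toMatrix v v S j i = c * μ := by
    rw [← hμ, hS, toMatrix_half_twist_apply v hv, toMatrix_half_twist_apply v hv]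
    ring
  have hne' : LinearMap.toMatrix v v S j i ≠ 0 := by
    have hl : ∀ k, lam k ≠ 0 := fun k => left_ne_zero_of_mul_eq_one (hlam k)
    rw [hS, toMatrix_half_twist_apply v hv]
    exact mul_ne_zero (mul_ne_zero (hl j) hne) (hl i)
  have hreal : μ * r = Complex.normSq (LinearMap.toMatrix v v S j i) * s := by
    apply Complex.ofReal_injective
    apply mul_left_cancel₀ h.ne_zero
    rw [Complex.ofReal_mul, Complex.ofReal_mul, Complex.normSq_eq_conj_mul_self]
    linear_combination LinearMap.toMatrix v v S j i * hrel - r * hμ'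
  have hpos : 0 < μ * r := by
    rw [hreal]
    exact mul_pos (Complex.normSq_pos.mpr hne') hs
  exact pos_of_mul_pos_left hpos hr.le

end Unitarity

/-! ### Assembly of the theorem -/

section Main

variable {d : ℕ} {V : Type*} [AddCommGroup V] [Module ℂ V] [FiniteDimensional ℂ V]

/-- Conjugation by S exchanges A and B, so S² commutes with both and Schur's lemma applies. -/
theorem exists_isBraidPair [Nontrivial V] (ρ : Representation ℂ BraidGroup3 V)
    (hρ : ρ.IsIrreducible) : ∃ c, IsBraidPair (ρ sigma1) (ρ sigma2) c := by
  have hbraid : ρ sigma1 * ρ sigma2 * ρ sigma1 = ρ sigma2 * ρ sigma1 * ρ sigma2 := by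
    simp only [← map_mul, braid_sigma]
  have hl : ρ sigma1 * (ρ sigma1 * ρ sigma2 * ρ sigma1) =
      ρ sigma1 * ρ sigma2 * ρ sigma1 * ρ sigma2 := by
    nth_rewrite 1 [hbraid]
    noncomm_ring
  have hr : ρ sigma2 * (ρ sigma1 * ρ sigma2 * ρ sigma1) =
      ρ sigma1 * ρ sigma2 * ρ sigma1 * ρ sigma1 := by
    nth_rewrite 2 [hbraid]
    noncomm_ring
  obtain ⟨c, hc⟩ := (jointlyIrreducible_of_isIrreducible ρ hρ).exists_eq_smul_one
    (Z := (ρ sigma1 * ρ sigma2 * ρ sigma1) * (ρ sigma1 * ρ sigma2 * ρ sigma1))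
    (by rw [← mul_assoc, hl, mul_assoc, hr]; simp only [mul_assoc])
    (by rw [← mul_assoc, hr, mul_assoc, hl]; simp only [mul_assoc])
  refine ⟨c, hbraid, hc, ?_⟩
  rintro rfl
  obtain ⟨x, hx⟩ := exists_ne (0 : V)
  have hinj : ∀ g, Function.Injective (ρ g) := fun g x y hxy => by
    simpa using congrArg (ρ g⁻¹) hxy
  have h0 := congrArg (· x) hc
  simp only [← map_mul, zero_smul, LinearMap.zero_apply] at h0
  exact hx (hinj _ (h0.trans (map_zero _).symm))

/-- The off-diagonal values are given by the formula, which is real. -/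
theorem exists_isBraidRoot_formula [NeZero d] (hd : d ≤ 5) (hV : Module.finrank ℂ V = d)
    (ρ : Representation ℂ BraidGroup3 V) {lam : Fin d → ℂ} (hinj : Function.Injective lam)
    (hlam : ∀ i, lam i * conj (lam i) = 1) {c : ℂ}
    (h : IsBraidPair (ρ sigma1) (ρ sigma2) c)
    (hirr : JointlyIrreducible (ρ sigma1) (ρ sigma2)) (v : Module.Basis (Fin d) ℂ V)
    (hv : ∀ i, ρ sigma1 (v i) = lam i • v i) :
    ∃ γ : ℂ, IsBraidRoot ρ lam γ ∧ ∀ i j, i ≠ j →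
      lam i ^ 2 * lam j ^ 2 * (LinearMap.toMatrix v v (ρ sigma2) i j *
        LinearMap.toMatrix v v (ρ sigma2) j i) = c * muFormula lam γ i j ∧
      conj (muFormula lam γ i j) = muFormula lam γ i j := by
  have hl : ∀ k, lam k ≠ 0 := fun k => left_ne_zero_of_mul_eq_one (hlam k)
  have hb := h.isBraidMatrix v hv hl
  have hdet := det_eq_prod_eigenvalues v hv
  have t₁ := sum_diag_eq_trace (B := ρ sigma2) v hv
  have t₂ := sum_sq_diag_eq_trace (B := ρ sigma2) v hv
  have t₃ := h.sum_cube_diag_eq_trace v hv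
  have hprod : (∏ i, lam i) * conj (∏ i, lam i) = 1 := by
    rw [map_prod, ← Finset.prod_mul_distrib]
    exact Finset.prod_eq_one fun i _ => hlam i
  have hroot : ∀ (γ : ℂ) (n : ℕ), n ≠ 0 → γ ^ n = ∏ i, lam i → γ * conj γ = 1 := by
    intro γ n hn hγ
    rw [← hγ, map_pow, ← mul_pow, Complex.mul_conj, ← Complex.ofReal_pow, Complex.ofReal_eq_one,
      pow_eq_one_iff_of_nonneg (Complex.normSq_nonneg _) hn] at hprod
    rw [Complex.mul_conj, hprod, Complex.ofReal_one]
  have htwist : ρ ((sigma1 * sigma2) ^ 3) = c • (1 : Module.End ℂ V) := by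
    rw [map_pow, map_mul, pow_succ, pow_two, h.mul_cube]
  have hformula : ∀ {γ : ℂ} {i j : Fin d},
      lam i ^ 2 * lam j ^ 2 * (LinearMap.toMatrix v v (ρ sigma2) i j *
        LinearMap.toMatrix v v (ρ sigma2) j i) *
        ((∏ k ∈ Finset.univ.erase i, (lam i - lam k)) *
          ∏ k ∈ Finset.univ.erase j, (lam j - lam k)) = c * braidQ lam γ i j →
      lam i ^ 2 * lam j ^ 2 * (LinearMap.toMatrix v v (ρ sigma2) i j *
        LinearMap.toMatrix v v (ρ sigma2) j i) = c * muFormula lam γ i j := by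
    intro γ i j hcl
    rw [muFormula, ← mul_div_assoc, ← hcl, mul_div_cancel_right₀]
    exact mul_ne_zero (prod_erase_sub_ne_zero hinj i) (prod_erase_sub_ne_zero hinj j)
  have hpos : 0 < d := Nat.pos_of_ne_zero (NeZero.ne d)
  obtain rfl | rfl | rfl | rfl | rfl : d = 1 ∨ d = 2 ∨ d = 3 ∨ d = 4 ∨ d = 5 := by omega
  · exact ⟨0, ⟨by norm_num, by norm_num⟩, fun i j hij => absurd (Subsingleton.elim i j) hij⟩
  · obtain ⟨hc, hT, -, -⟩ := h.traces_two hirr hV hdet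
    exact ⟨0, ⟨by norm_num, by norm_num⟩, fun i j hij =>
      ⟨hformula (hb.cleared_formula_two hc (t₁.trans hT) hij 0),
        conj_muFormula (by norm_num) hlam (conj_braidQ_two hlam 0 hij)⟩⟩
  · obtain ⟨hc, hT, hS, -⟩ := h.traces_three hirr hV hdet
    exact ⟨0, ⟨by norm_num, by norm_num⟩, fun i j hij =>
      ⟨hformula (hb.cleared_formula_three hc (t₁.trans hT) (t₂.trans hS) hij 0),
        conj_muFormula (by norm_num) hlam (conj_braidQ_three hlam 0 hij)⟩⟩
  · obtain ⟨γ, hγ, hc, hT, hS, hTT⟩ := h.traces_four hirr hV hdet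
    exact ⟨γ, ⟨fun _ => ⟨hγ, hc ▸ htwist⟩, by norm_num⟩, fun i j hij =>
      ⟨hformula (hb.cleared_formula_four hγ hc (t₁.trans hT) (t₂.trans hS) (t₃.trans hTT) hij),
        conj_muFormula (by norm_num) hlam
          (conj_braidQ_four hlam (hroot γ 2 (by norm_num) hγ) hγ hij)⟩⟩
  · obtain ⟨γ, hγ, hc, hT, hS, hTT⟩ := h.traces_five hirr hV hdet
    exact ⟨γ, ⟨by norm_num, fun _ => ⟨hγ, hc ▸ htwist⟩⟩, fun i j hij =>
      ⟨hformula (hb.cleared_formula_five hinj hγ hc (t₁.trans hT) (t₂.trans hS) (t₃.trans hTT)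
        hij), conj_muFormula (by norm_num) hlam
          (conj_braidQ_five hlam (hroot γ 5 (by norm_num) hγ) hij)⟩⟩

end Main

theorem mainTheorem1 {d : ℕ} [NeZero d] (hd : d ≤ 5)
    {V : Type*} [AddCommGroup V] [Module ℂ V] [FiniteDimensional ℂ V]
    (hV : Module.finrank ℂ V = d)
    (ρ : Representation ℂ BraidGroup3 V) (hρ : ρ.IsIrreducible)
    (lam : Fin d → ℂ) (hinj : Function.Injective lam)
    (heig : ∀ i, Module.End.HasEigenvalue (ρ sigma1) (lam i))
    (hnorm : ∀ i, ‖lam i‖ = 1) :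
    (∃! μ : Fin d → Fin d → ℝ, IsMu ρ lam μ) ∧
    ∀ μ : Fin d → Fin d → ℝ, IsMu ρ lam μ →
      (∃ γ : ℂ, IsBraidRoot ρ lam γ ∧ ∀ i j, i ≠ j → (μ i j : ℂ) = muFormula lam γ i j) ∧
      (IsUnitarizable ρ ↔ ∀ i : Fin d, i ≠ 0 → 0 < μ 0 i) := by
  have hlam : ∀ i, lam i * conj (lam i) = 1 := fun i => by
    rw [Complex.mul_conj, Complex.normSq_eq_norm_sq, hnorm]; simp
  have hl : ∀ k, lam k ≠ 0 := fun k => left_ne_zero_of_mul_eq_one (hlam k)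
  have hVpos : 0 < Module.finrank ℂ V := hV ▸ Nat.pos_of_ne_zero (NeZero.ne d)
  have : Nontrivial V := Module.nontrivial_of_finrank_pos hVpos
  obtain ⟨c, h⟩ := exists_isBraidPair ρ hρ
  have hirr := jointlyIrreducible_of_isIrreducible ρ hρ
  choose u hu using fun i => (heig i).exists_hasEigenvector
  obtain ⟨v, hvu⟩ : ∃ v : Module.Basis (Fin d) ℂ V, ∀ i, v i = u i :=
    ⟨basisOfLinearIndependentOfCardEqFinrank
      (Module.End.eigenvectors_linearIndependent' _ lam hinj u hu) (by simp [hV]), fun i => by simp⟩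
  have hv : ∀ i, ρ sigma1 (v i) = lam i • v i := fun i => by rw [hvu]; exact (hu i).apply_eq_smul
  have hb := h.isBraidMatrix v hv hl
  have hcn : ‖c‖ = 1 := by
    have h1 := congrArg norm h.scalar_pow_finrank
    rw [det_eq_prod_eigenvalues v hv, norm_pow, norm_pow, norm_prod,
      Finset.prod_eq_one fun i _ => hnorm i, one_pow] at h1
    exact (pow_eq_one_iff_of_nonneg (norm_nonneg c) hVpos.ne').mp h1
  have hc : c * conj c = 1 := by
    rw [Complex.mul_conj, Complex.normSq_eq_norm_sq, hcn]; simp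
  obtain ⟨b, hbdef⟩ : ∃ b, b = LinearMap.toMatrix v v (ρ sigma2) := ⟨_, rfl⟩
  have hmu : ∀ μ : Fin d → Fin d → ℝ, IsMu ρ lam μ ↔
      ∀ i j, lam i ^ 2 * lam j ^ 2 * (b i j * b j i) = c * μ i j := by
    intro μ
    refine forall_congr' fun i => forall_congr' fun j => ?_
    have h1 := h.eigenProj_mul_mul v hinj hv i j
    rw [← hbdef] at h1
    rw [← (smul_right_injective (Module.End ℂ V) h.ne_zero).eq_iff]
    rw [h1, smul_smul, (smul_left_injective ℂ (h.eigenProj_ne_zero v hinj hv i)).eq_iff]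
  obtain ⟨γ, hγ, hform⟩ := exists_isBraidRoot_formula hd hV ρ hinj hlam h hirr v hv
  obtain ⟨htS, htT⟩ := h.conj_traces hcn
  have hdiag := hb.diag_real hd hinj hlam hc
    (by rw [sum_sq_diag_eq_trace v hv]; exact htS)
    (by rw [h.sum_cube_diag_eq_trace v hv, sum_diag_eq_trace v hv]; exact htT)
  have hne : ∀ i j, i ≠ j → b i j ≠ 0 := fun i j hij => by
    rw [hbdef]
    exact hb.entry_ne_zero hd hinj (hirr.eq_univ_of_entry_eq_zero v hv) hij
  rw [← hbdef] at hb hdiag hform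
  have hex : ∀ i j, ∃ r : ℝ, lam i ^ 2 * lam j ^ 2 * (b i j * b j i) = c * r := by
    intro i j
    by_cases hij : i = j
    · subst hij
      -- On the diagonal, λ_i⁴ b_ii = c · conj(b_ii) gives μ_ii = |b_ii|².
      refine ⟨Complex.normSq (b i i), ?_⟩
      rw [Complex.normSq_eq_conj_mul_self]
      linear_combination b i i * hdiag i
    · obtain ⟨h1, h2⟩ := hform i j hij
      refine ⟨(muFormula lam γ i j).re, ?_⟩
      rw [h1, Complex.conj_eq_iff_re.mp h2]
  choose m hm using hex
  refine ⟨⟨m, (hmu m).mpr hm, fun μ hμ => ?_⟩, fun μ hμ => ⟨⟨γ, hγ, fun i j hij => ?_⟩, ?_, ?_⟩⟩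
  · ext i j
    have h1 := ((hmu μ).mp hμ i j).symm.trans (hm i j)
    exact_mod_cast mul_left_cancel₀ h.ne_zero h1
  · exact mul_left_cancel₀ h.ne_zero (((hmu μ).mp hμ i j).symm.trans (hform i j hij).1)
  · intro hun i hi
    refine hun.mu_pos v h hinj hv hlam (i := 0) (j := i) ?_ ?_
    · rw [← hbdef]; exact hne i 0 hi
    · rw [← hbdef]; exact (hmu μ).mp hμ 0 i
  · intro hpos
    obtain ⟨w, hw, hrel⟩ := hb.exists_weights hd hinj hlam hc hdiag μ ((hmu μ).mp hμ) hne hpos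
    rw [hbdef] at hrel
    exact isUnitarizable_of_weights ρ v h hv hlam w hw hrel
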